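/- Let $d\in\{2,3\}$, let $1<p<\infty$, let $\Omega\subset\mathbb{R}^d$ be a bounded polyhedral domain, and let $$\lambda_1:=\inf_{v\in W_0^{1,p}(\Omega)\setminus\{0\}}\frac{\int_\Omega|\nabla v|^p\,dx}{\int_\Omega|v|^p\,dx}$$ be the first Dirichlet eigenvalue of the $p$-Laplacian on $\Omega$. For a (finite) conforming triangulation $\mathcal{T}$ of $\overline{\Omega}$ into closed $d$-simplices, let $V_{\mathcal{T}}^{\mathrm{CR}}$ be the Crouzeix--Raviart space of all functions $v$ on $\Omega$ whose restriction to each $T\in\mathcal{T}$ is affine and which satisfy $\int_F[v]\,ds=0$ for every $(d-1)$-dimensional face $F$ of an element of $\mathcal{T}$, where the jump $[v]$ is the difference of the traces of $v$ from the two elements that share $F$ if $F$ is an interior face, and the trace of $v$ itself if $F\subset\partial\Omega$. A discrete solution on $\mathcal{T}$ is a pair $(\mu,u)$ with $u\in V_{\mathcal{T}}^{\mathrm{CR}}\setminus\{0\}$ and $$\mu=\mathcal{J}_{\mathcal{T}}(u)=\min_{v\in V_{\mathcal{T}}^{\mathrm{CR}}\setminus\{0\}}\mathcal{J}_{\mathcal{T}}(v),\qquad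 \mathcal{J}_{\mathcal{T}}(v):=\frac{\sum_{T\in\mathcal{T}}\int_T|\nabla v|^p\,dx}{\int_\Omega|v|^p\,dx}.$$ Let $(\mathcal{T}_k)_{k\ge0}$ be a sequence of conforming triangulations of $\overline{\Omega}$ (for instance a nested one, generated by successive bisection), and let $(\mu_k,u_k)$ be a discrete solution on $\mathcal{T}_k$ for each $k\ge 0$. If, for some $k$, $$\Big(1+\frac d2\Big)\max_{T\in\mathcal{T}_k}\mathrm{diam}(T)\,\lambda_1^{1/p}<1,$$ then $$\frac{\mu_k^{1/p}}{1+\big(1+\frac d2\big)\max_{T\in\mathcal{T}_k}\mathrm{diam}(T)\,\mu_k^{1/p}}\le\lambda_1^{1/p}.$$ -/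

import Mathlib

open MeasureTheory Topology Filter Set
open scoped ENNReal ContDiff

noncomputable section

namespace PLaplaceCR

variable {d : ℕ}

/-! ### Sobolev space with zero boundary values and the first eigenvalue -/

/-- Test functions: smooth real functions with compact support contained in `Ω`. -/
def IsTestFunction (Ω : Set (EuclideanSpace ℝ (Fin d))) (φ : EuclideanSpace ℝ (Fin d) → ℝ) : Prop :=
  ContDiff ℝ ∞ φ ∧ HasCompactSupport φ ∧ tsupport φ ⊆ Ω

/-- `g` is a weak (distributional) gradient of `u` on `Ω`. -/
def HasWeakGradient (Ω : Set (EuclideanSpace ℝ (Fin d))) (u : EuclideanSpace ℝ (Fin d) → ℝ)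
    (g : EuclideanSpace ℝ (Fin d) → EuclideanSpace ℝ (Fin d)) : Prop :=
  ∀ φ, IsTestFunction Ω φ → ∫ x in Ω, u x • gradient φ x = -∫ x in Ω, φ x • g x

/-- `u` belongs to `W₀^{1,p}(Ω)` and has weak gradient `g`: both are in `L^p(Ω)`, and `u` is a limit
of test functions in the norm of `W^{1,p}(Ω)`. -/
structure MemW0 (p : ℝ) (Ω : Set (EuclideanSpace ℝ (Fin d))) (u : EuclideanSpace ℝ (Fin d) → ℝ)
    (g : EuclideanSpace ℝ (Fin d) → EuclideanSpace ℝ (Fin d)) : Prop where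
  memLp : MemLp u (ENNReal.ofReal p) (volume.restrict Ω)
  memLp_grad : MemLp g (ENNReal.ofReal p) (volume.restrict Ω)
  weakGradient : HasWeakGradient Ω u g
  approx : ∃ φ : ℕ → EuclideanSpace ℝ (Fin d) → ℝ, (∀ n, IsTestFunction Ω (φ n)) ∧
    Tendsto (fun n => eLpNorm (fun x => φ n x - u x) (ENNReal.ofReal p) (volume.restrict Ω))
      atTop (𝓝 0) ∧
    Tendsto (fun n => eLpNorm (fun x => gradient (φ n) x - g x) (ENNReal.ofReal p)
      (volume.restrict Ω)) atTop (𝓝 0)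

/-- The first Dirichlet eigenvalue of the `p`-Laplacian on `Ω`: the infimum of the Rayleigh quotient
`∫_Ω |∇v|^p / ∫_Ω |v|^p` over the nonzero `v ∈ W₀^{1,p}(Ω)`. -/
def firstEigenvalue (p : ℝ) (Ω : Set (EuclideanSpace ℝ (Fin d))) : ℝ :=
  sInf {r : ℝ | ∃ v g, MemW0 p Ω v g ∧ ¬ (v =ᵐ[volume.restrict Ω] 0) ∧
    r = (∫ x in Ω, ‖g x‖ ^ p) / ∫ x in Ω, |v x| ^ p}

/-! ### Conforming triangulations -/

/-- A conforming triangulation of `closure Ω`: a finite simplicial complex whose underlying space is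
`closure Ω`. The triangulation in the usual sense is the set `cells` of its simplices of full
dimension (when `Ω` is open, every simplex of the complex is a face of one of them). -/
structure Triangulation (Ω : Set (EuclideanSpace ℝ (Fin d))) extends
    Geometry.SimplicialComplex ℝ (EuclideanSpace ℝ (Fin d)) where
  finite_faces : faces.Finite
  space_eq : toSimplicialComplex.space = closure Ω

namespace Triangulation

variable {Ω : Set (EuclideanSpace ℝ (Fin d))}

/-- The elements (`d`-simplices), given by their vertex sets. -/
def cells (𝒯 : Triangulation Ω) : Finset (Finset (EuclideanSpace ℝ (Fin d))) :=
  𝒯.finite_faces.toFinset.filter fun T => T.card = d + 1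

/-- The `(d-1)`-dimensional faces of the elements, given by their vertex sets. -/
def facets (𝒯 : Triangulation Ω) : Set (Finset (EuclideanSpace ℝ (Fin d))) :=
  {F | F.card = d ∧ ∃ T ∈ 𝒯.cells, F ⊆ T}

/-- The largest diameter of an element. -/
def maxDiam (𝒯 : Triangulation Ω) : ℝ :=
  ⨆ T : 𝒯.cells, Metric.diam (convexHull ℝ (T.1 : Set (EuclideanSpace ℝ (Fin d))))

/-- Piecewise affine functions, without continuity: a function is given by its restrictions
`v|_T ∈ P₁(T)` to the elements. -/
abbrev PiecewiseAffine (𝒯 : Triangulation Ω) : Type :=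
  𝒯.cells → EuclideanSpace ℝ (Fin d) →ᵃ[ℝ] ℝ

/-- The piecewise affine function as a function on space, with value `v|_T` in the interior of each
element `T` (and the value `0` on the null set of points that are interior to no element). -/
def toFun (𝒯 : Triangulation Ω) (v : 𝒯.PiecewiseAffine) (x : EuclideanSpace ℝ (Fin d)) : ℝ :=
  ∑ T : 𝒯.cells,
    (interior (convexHull ℝ (T.1 : Set (EuclideanSpace ℝ (Fin d))))).indicator (fun y => v T y) x

/-- The Crouzeix-Raviart space: the jumps have integral zero over every facet (with respect to
surface measure). On a facet inside `∂Ω` the jump is the trace itself; on any other facet it is, up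
to sign, the difference of the traces from the two adjacent elements. -/
def crouzeixRaviart (𝒯 : Triangulation Ω) : Set 𝒯.PiecewiseAffine :=
  {v | ∀ F ∈ 𝒯.facets,
    (convexHull ℝ (F : Set (EuclideanSpace ℝ (Fin d))) ⊆ frontier Ω →
      ∀ T : 𝒯.cells, F ⊆ T.1 →
        ∫ x in convexHull ℝ (F : Set (EuclideanSpace ℝ (Fin d))), v T x ∂μH[(d : ℝ) - 1] = 0) ∧
    (¬ convexHull ℝ (F : Set (EuclideanSpace ℝ (Fin d))) ⊆ frontier Ω →
      ∀ T₁ T₂ : 𝒯.cells, F ⊆ T₁.1 → F ⊆ T₂.1 →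
        ∫ x in convexHull ℝ (F : Set (EuclideanSpace ℝ (Fin d))), (v T₁ x - v T₂ x)
          ∂μH[(d : ℝ) - 1] = 0)}

/-- The discrete Rayleigh quotient `∑_T ∫_T |∇v|^p / ∫_Ω |v|^p`. -/
def rayleigh (𝒯 : Triangulation Ω) (p : ℝ) (v : 𝒯.PiecewiseAffine) : ℝ :=
  (∑ T : 𝒯.cells, ∫ x in convexHull ℝ (T.1 : Set (EuclideanSpace ℝ (Fin d))),
    ‖gradient (fun y => v T y) x‖ ^ p) / ∫ x in Ω, |𝒯.toFun v x| ^ p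

/-- `(μ, u)` is a discrete solution: `u` is a nonzero Crouzeix-Raviart function that minimizes the
discrete Rayleigh quotient over all nonzero Crouzeix-Raviart functions, and `μ` is the minimum. -/
structure IsDiscreteSolution (𝒯 : Triangulation Ω) (p : ℝ) (μ : ℝ) (u : 𝒯.PiecewiseAffine) :
    Prop where
  mem : u ∈ 𝒯.crouzeixRaviart
  ne_zero : u ≠ 0
  rayleigh_eq : 𝒯.rayleigh p u = μ
  isMin : ∀ v ∈ 𝒯.crouzeixRaviart, v ≠ 0 → μ ≤ 𝒯.rayleigh p v

end Triangulation

end PLaplaceCR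

end

/-!
Lower bounds for the first Dirichlet eigenvalue of the `p`-Laplacian by Crouzeix–Raviart elements.

Since `W₀^{1,p}(Ω)` is the closure of the test functions, it suffices to show
`μ^(1/p) ‖φ‖ ≤ (1 + κ h μ^(1/p)) ‖∇φ‖` for every test function `φ`, with `L^p` norms on `Ω`, the
largest diameter `h` and `κ = 1 + d/2` (`IsDiscreteSolution.eLpNorm_le`). Let `w` be the
Crouzeix–Raviart interpolant of `φ`, which has the same facet means as `φ`. It is admissible in the
discrete problem. On each cell its gradient is the mean of `∇φ`, so that `‖∇w‖ ≤ ‖∇φ‖` by Jensen's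
inequality, and minimality of `μ` gives `μ^(1/p) ‖w‖ ≤ ‖∇φ‖`. The claim follows from
`‖φ‖ ≤ ‖w‖ + ‖φ - w‖` and the interpolation error estimate `‖φ - w‖ ≤ κ h ‖∇φ‖`
(`lintegral_sub_crInterpolant_rpow_le`).

*The interpolant.* On a simplex `T` with barycenter `b` it is
`x ↦ ⨍ φ + (1/d) ⨍ ∇φ(y) ⬝ (y - b) dy + (⨍ ∇φ) ⬝ (x - b)`. That it reproduces the facet means follows
from the divergence theorem for the field `ψ(y) (y - P)`, whose flux vanishes through all facets that
contain the vertex `P`. This is proved on a cone by Fubini's theorem and integration along rays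
(`integral_cone_eq`); Hausdorff measure on the facet enters only as a Haar measure on its direction.

*The error estimate.* All points of `T` have distance at most `d/(d+1) h` from `b`, so the last two
terms of the interpolant contribute `(d/(d+1) + 1/(d+1)) h ‖∇φ‖ = h ‖∇φ‖`. The remaining difference
`φ - ⨍ φ` is bounded by the Poincaré inequality with constant `d/2 * h`. To get this constant for
all `p`, the function is pulled back to the unit cube by the map that sorts the coordinates and then
maps the simplex of sorted points affinely onto `T`. This map transports Lebesgue measure to the
uniform distribution on `T` (`map_sortMap_cubeMeasure`), and it moves along edges of `T` when one
coordinate varies, so that all partial derivatives of the pulled back function are at most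
`h ‖∇φ‖`. On the cube, averaging over one coordinate after the other reduces the inequality to the
unit interval, where Schur's test gives the constant `1/2` for every `p`.
-/

noncomputable section

namespace PLaplaceCR

/-! ### Poincaré inequality on the unit cube -/

section UnitCube

/-- Jensen's inequality for the `p`-th power and a probability measure. -/
lemma rpow_lintegral_le_lintegral_rpow {X : Type*} [MeasurableSpace X] {μ : Measure X}
    [IsProbabilityMeasure μ] {p : ℝ} (hp : 1 < p) {f : X → ℝ≥0∞} (hf : AEMeasurable f μ) :
    (∫⁻ x, f x ∂μ) ^ p ≤ ∫⁻ x, f x ^ p ∂μ := by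
  have hpq := Real.HolderConjugate.conjExponent hp
  have h := ENNReal.lintegral_mul_le_Lp_mul_Lq μ hpq hf (aemeasurable_const (b := (1 : ℝ≥0∞)))
  simp only [Pi.mul_apply, mul_one, ENNReal.one_rpow, lintegral_const, measure_univ] at h
  calc _ ≤ ((∫⁻ x, f x ^ p ∂μ) ^ (1 / p)) ^ p := ENNReal.rpow_le_rpow h (by linarith)
    _ = _ := by rw [← ENNReal.rpow_mul, one_div_mul_cancel (by linarith), ENNReal.rpow_one]

/-- Schur test: a nonnegative kernel whose integrals in either variable are at most `C` acts on
`L^p` with norm at most `C`. -/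
lemma lintegral_rpow_kernel_le {X Y : Type*} [MeasurableSpace X] [MeasurableSpace Y]
    {μ : Measure X} {ν : Measure Y} [SFinite μ] [SFinite ν] {p : ℝ} (hp : 1 < p)
    {k : X → Y → ℝ≥0∞} (hk : Measurable (Function.uncurry k)) {G : Y → ℝ≥0∞} (hG : Measurable G)
    {C : ℝ≥0∞} (h₁ : ∀ᵐ x ∂μ, ∫⁻ y, k x y ∂ν ≤ C) (h₂ : ∀ᵐ y ∂ν, ∫⁻ x, k x y ∂μ ≤ C) :
    ∫⁻ x, (∫⁻ y, k x y * G y ∂ν) ^ p ∂μ ≤ C ^ p * ∫⁻ y, G y ^ p ∂ν := by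
  have hp0 : 0 < p := by linarith
  have hpq := Real.HolderConjugate.conjExponent hp
  set q := Real.conjExponent p
  have hq0 : 0 < q := hpq.symm.pos
  have hkx : ∀ x, Measurable (k x) := fun x => hk.of_uncurry_left
  have step : ∀ᵐ x ∂μ, (∫⁻ y, k x y * G y ∂ν) ^ p ≤
      C ^ (p - 1) * ∫⁻ y, k x y * G y ^ p ∂ν := by
    filter_upwards [h₁] with x hx
    have h := ENNReal.lintegral_mul_le_Lp_mul_Lq ν hpq
      (f := fun y => k x y ^ (1 / p) * G y) (g := fun y => k x y ^ (1 / q))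
      (((hkx x).pow_const _).mul hG).aemeasurable ((hkx x).pow_const _).aemeasurable
    have e1 : ∀ y, ((fun y => k x y ^ (1 / p) * G y) * fun y => k x y ^ (1 / q)) y
        = k x y * G y := by
      intro y
      simp only [Pi.mul_apply]
      rw [mul_right_comm, ← ENNReal.rpow_add_of_nonneg _ _ (by positivity) (by positivity)]
      rw [one_div, one_div, hpq.inv_add_inv_eq_one, ENNReal.rpow_one]
    have e2 : ∀ y, (k x y ^ (1 / p) * G y) ^ p = k x y * G y ^ p := by
      intro y
      rw [ENNReal.mul_rpow_of_nonneg _ _ hp0.le, ← ENNReal.rpow_mul,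
        one_div_mul_cancel hp0.ne', ENNReal.rpow_one]
    have e3 : ∀ y, (k x y ^ (1 / q)) ^ q = k x y := by
      intro y
      rw [← ENNReal.rpow_mul, one_div_mul_cancel hq0.ne', ENNReal.rpow_one]
    simp only [e1, e2, e3] at h
    calc (∫⁻ y, k x y * G y ∂ν) ^ p
        ≤ ((∫⁻ y, k x y * G y ^ p ∂ν) ^ (1 / p) * (∫⁻ y, k x y ∂ν) ^ (1 / q)) ^ p :=
          ENNReal.rpow_le_rpow h hp0.le
      _ = (∫⁻ y, k x y * G y ^ p ∂ν) * (∫⁻ y, k x y ∂ν) ^ (p - 1) := by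
          rw [ENNReal.mul_rpow_of_nonneg _ _ hp0.le, ← ENNReal.rpow_mul,
            one_div_mul_cancel hp0.ne', ENNReal.rpow_one, ← ENNReal.rpow_mul]
          rw [one_div, mul_comm q⁻¹, ← div_eq_mul_inv, hpq.div_conj_eq_sub_one]
      _ ≤ (∫⁻ y, k x y * G y ^ p ∂ν) * C ^ (p - 1) := by
          gcongr
      _ = _ := mul_comm _ _
  have hkG : Measurable (Function.uncurry fun x y => k x y * G y ^ p) :=
    hk.mul ((hG.comp measurable_snd).pow_const p)
  calc _ ≤ ∫⁻ x, C ^ (p - 1) * ∫⁻ y, k x y * G y ^ p ∂ν ∂μ := lintegral_mono_ae step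
    _ = C ^ (p - 1) * ∫⁻ y, ∫⁻ x, k x y * G y ^ p ∂μ ∂ν := by
        have hm : Measurable fun x => ∫⁻ y, k x y * G y ^ p ∂ν := hkG.lintegral_prod_right'
        rw [lintegral_const_mul _ hm, lintegral_lintegral_swap
          hkG.aemeasurable]
    _ ≤ C ^ (p - 1) * ∫⁻ y, C * G y ^ p ∂ν := by
        refine mul_le_mul_right (lintegral_mono_ae ?_) _
        filter_upwards [h₂] with y hy
        rw [lintegral_mul_const _ hk.of_uncurry_right]
        gcongr
    _ = _ := by
        rw [lintegral_const_mul _ (hG.pow_const p), ← mul_assoc]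
        congr 1
        nth_rw 2 [← ENNReal.rpow_one C]
        rw [← ENNReal.rpow_add_of_nonneg _ _ (by linarith) zero_le_one, sub_add_cancel]

/-- Lebesgue measure on the unit interval. -/
def unitMeasure : Measure ℝ := volume.restrict (Icc 0 1)

instance : IsProbabilityMeasure unitMeasure := ⟨by simp [unitMeasure]⟩

/-- The kernel that bounds the deviation from the mean on the unit interval by the derivative. -/
def meanKernel (s z : ℝ) : ℝ≥0∞ := if z ≤ s then ENNReal.ofReal z else ENNReal.ofReal (1 - z)

lemma measurable_meanKernel : Measurable (Function.uncurry meanKernel) := by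
  unfold meanKernel
  apply Measurable.ite (measurableSet_le measurable_snd measurable_fst)
  · exact measurable_snd.ennreal_ofReal
  · exact (measurable_const.sub measurable_snd).ennreal_ofReal

lemma lintegral_meanKernel_right_le {s : ℝ} (hs : s ∈ Icc (0 : ℝ) 1) :
    ∫⁻ z, meanKernel s z ∂unitMeasure ≤ 1 / 2 := by
  have hle : ∀ z ∈ Icc (0 : ℝ) 1, meanKernel s z =
      ENNReal.ofReal (if z ≤ s then z else 1 - z) := by
    intro z hz; unfold meanKernel; split_ifs <;> rfl
  have hI : ∀ a b : ℝ, IntervalIntegrable (fun z : ℝ => if z ≤ s then z else 1 - z) volume a b := by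
    intro a b
    have h1 : IntervalIntegrable (fun z : ℝ => z) volume a b := continuous_id.intervalIntegrable _ _
    have h2 : IntervalIntegrable (fun z : ℝ => 1 - z) volume a b :=
      (continuous_const.sub continuous_id).intervalIntegrable _ _
    rw [intervalIntegrable_iff] at *
    exact Integrable.piecewise (s := {z | z ≤ s}) (measurableSet_le measurable_id measurable_const)
      h1.integrableOn h2.integrableOn
  have hI01 := hI 0 1
  rw [intervalIntegrable_iff_integrableOn_Icc_of_le zero_le_one] at hI01
  rw [unitMeasure, setLIntegral_congr_fun measurableSet_Icc hle,
    ← ofReal_integral_eq_lintegral_ofReal hI01]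
  · rw [integral_Icc_eq_integral_Ioc, ← intervalIntegral.integral_of_le zero_le_one,
      ← intervalIntegral.integral_add_adjacent_intervals (hI 0 s) (hI s 1)]
    have e1 : ∫ z in (0 : ℝ)..s, (if z ≤ s then z else 1 - z) = ∫ z in (0 : ℝ)..s, z := by
      apply intervalIntegral.integral_congr
      intro z hz
      rw [uIcc_of_le hs.1] at hz
      simp [hz.2]
    have e2 : ∫ z in s..1, (if z ≤ s then z else 1 - z) = ∫ z in s..1, (1 - z) := by
      rw [intervalIntegral.integral_of_le hs.2, intervalIntegral.integral_of_le hs.2]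
      apply setIntegral_congr_fun measurableSet_Ioc
      intro z hz
      simp [hz.1]
    rw [e1, e2, integral_id, intervalIntegral.integral_sub (by simp) (by simp), integral_id]
    have : (1 / 2 : ℝ≥0∞) = ENNReal.ofReal (1 / 2) := by
      rw [ENNReal.ofReal_div_of_pos (by norm_num)]; simp
    rw [this]
    apply ENNReal.ofReal_le_ofReal
    simp
    nlinarith [hs.1, hs.2]
  · filter_upwards [ae_restrict_mem measurableSet_Icc] with z hz
    simp only [Pi.zero_apply]
    split_ifs
    · exact hz.1
    · linarith [hz.2]

lemma lintegral_meanKernel_left_le {z : ℝ} (hz : z ∈ Icc (0 : ℝ) 1) :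
    ∫⁻ s, meanKernel s z ∂unitMeasure ≤ 1 / 2 := by
  have e : ∀ s, meanKernel s z = (Ici z).indicator (fun _ => ENNReal.ofReal z) s
      + (Iio z).indicator (fun _ => ENNReal.ofReal (1 - z)) s := by
    intro s
    unfold meanKernel
    by_cases h : z ≤ s
    · simp [h]
    · simp [h, not_le.1 h]
  simp_rw [e]
  rw [lintegral_add_left (measurable_const.indicator measurableSet_Ici),
    lintegral_indicator_const measurableSet_Ici, lintegral_indicator_const measurableSet_Iio,
    unitMeasure, Measure.restrict_apply measurableSet_Ici, Measure.restrict_apply measurableSet_Iio]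
  have h1 : volume (Ici z ∩ Icc (0 : ℝ) 1) ≤ ENNReal.ofReal (1 - z) := by
    rw [← Real.volume_Icc]
    exact measure_mono fun y hy => ⟨hy.1, hy.2.2⟩
  have h2 : volume (Iio z ∩ Icc (0 : ℝ) 1) ≤ ENNReal.ofReal z := by
    have : ENNReal.ofReal z = volume (Icc 0 z) := by simp
    rw [this]
    exact measure_mono fun y hy => ⟨hy.2.1, le_of_lt hy.1⟩
  calc _ ≤ ENNReal.ofReal z * ENNReal.ofReal (1 - z) + ENNReal.ofReal (1 - z) * ENNReal.ofReal z := by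
        gcongr
    _ = ENNReal.ofReal (2 * (z * (1 - z))) := by
        rw [← ENNReal.ofReal_mul hz.1, ← ENNReal.ofReal_mul (by linarith [hz.2]),
          ← ENNReal.ofReal_add]
        · ring_nf
        · exact mul_nonneg hz.1 (by linarith [hz.2])
        · exact mul_nonneg (by linarith [hz.2]) hz.1
    _ ≤ ENNReal.ofReal (1 / 2) := ENNReal.ofReal_le_ofReal (by nlinarith [sq_nonneg (z - 1 / 2)])
    _ = 1 / 2 := by rw [ENNReal.ofReal_div_of_pos (by norm_num)]; simp

/-- The `L^p`-Poincaré inequality on the unit interval, with constant `1 / 2` for every `p`. The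
function `G` plays the role of the absolute value of the derivative. -/
lemma lintegral_sub_mean_rpow_le {p : ℝ} (hp : 1 < p) {g : ℝ → ℝ} (hg : Integrable g unitMeasure)
    {G : ℝ → ℝ≥0∞} (hG : Measurable G)
    (h : ∀ a b, a ≤ b → ‖g b - g a‖ₑ ≤ ∫⁻ z in Ioc a b, G z) :
    ∫⁻ s, ‖g s - ∫ t, g t ∂unitMeasure‖ₑ ^ p ∂unitMeasure
      ≤ (1 / 2) ^ p * ∫⁻ z, G z ^ p ∂unitMeasure := by
  have hmem : ∀ᵐ s ∂unitMeasure, s ∈ Icc (0 : ℝ) 1 := ae_restrict_mem measurableSet_Icc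
  refine le_trans (lintegral_mono_ae ?_) (lintegral_rpow_kernel_le hp measurable_meanKernel hG
    (hmem.mono fun s hs => lintegral_meanKernel_right_le hs)
    (hmem.mono fun s hs => lintegral_meanKernel_left_le hs))
  filter_upwards [hmem] with s hs
  gcongr
  -- `G` is integrated over the segment between `t` and `s`, and then over `t`.
  let S : ℝ → ℝ → ℝ≥0∞ := fun t z => if (t < z ∧ z ≤ s) ∨ (s < z ∧ z ≤ t) then 1 else 0
  have hS : Measurable (Function.uncurry S) := by
    refine Measurable.ite ?_ measurable_const measurable_const
    exact ((measurableSet_lt measurable_fst measurable_snd).inter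
      (measurableSet_le measurable_snd measurable_const)).union
      ((measurableSet_lt measurable_const measurable_snd).inter
      (measurableSet_le measurable_snd measurable_fst))
  have hmean : ‖g s - ∫ t, g t ∂unitMeasure‖ₑ ≤ ∫⁻ t, ‖g s - g t‖ₑ ∂unitMeasure := by
    have : g s - ∫ t, g t ∂unitMeasure = ∫ t, (g s - g t) ∂unitMeasure := by
      rw [integral_sub (integrable_const _) hg]; simp
    rw [this]
    exact enorm_integral_le_lintegral_enorm _
  refine hmean.trans ?_
  calc ∫⁻ t, ‖g s - g t‖ₑ ∂unitMeasure
      ≤ ∫⁻ t, ∫⁻ z, S t z * G z ∂unitMeasure ∂unitMeasure := by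
        apply lintegral_mono_ae
        filter_upwards [hmem] with t ht
        have key : ∀ a b, a ∈ Icc (0 : ℝ) 1 → b ∈ Icc (0 : ℝ) 1 → a ≤ b →
            (∀ z, a < z → z ≤ b → S t z = 1) → ‖g b - g a‖ₑ ≤ ∫⁻ z, S t z * G z ∂unitMeasure := by
          intro a b ha hb hab hz
          refine (h a b hab).trans ?_
          have hsub : Ioc a b ⊆ Icc (0 : ℝ) 1 := fun z hz => ⟨ha.1.trans hz.1.le, hz.2.trans hb.2⟩
          calc ∫⁻ z in Ioc a b, G z = ∫⁻ z in Ioc a b, S t z * G z :=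
                setLIntegral_congr_fun measurableSet_Ioc fun z h => by simp [hz z h.1 h.2]
            _ ≤ _ := lintegral_mono' (Measure.restrict_mono hsub le_rfl) le_rfl
        rcases le_total t s with hts | hts
        · exact key t s ht hs hts fun z h1 h2 => by simp [S, h1, h2]
        · rw [← enorm_neg, neg_sub]
          exact key s t hs ht hts fun z h1 h2 => by simp [S, h1, h2]
    _ = ∫⁻ z, (∫⁻ t, S t z ∂unitMeasure) * G z ∂unitMeasure := by
        rw [lintegral_lintegral_swap (hS.mul (hG.comp measurable_snd)).aemeasurable]
        congr with z
        rw [lintegral_mul_const _ hS.of_uncurry_right]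
    _ ≤ ∫⁻ z, meanKernel s z * G z ∂unitMeasure := by
        apply lintegral_mono_ae
        filter_upwards [hmem] with z hz
        gcongr
        unfold meanKernel
        have hind : ∀ A : Set ℝ, MeasurableSet A → (∀ t, S t z ≤ A.indicator (fun _ => 1) t) →
            ∫⁻ t, S t z ∂unitMeasure ≤ volume (A ∩ Icc 0 1) := by
          intro A hA hle
          refine (lintegral_mono hle).trans ?_
          rw [lintegral_indicator_const hA, one_mul, unitMeasure, Measure.restrict_apply hA]
        split_ifs with hzs
        · refine (hind (Iio z) measurableSet_Iio fun t => ?_).trans ?_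
          · by_cases ht : t < z <;> simp [S, ht, hzs]
          · have : ENNReal.ofReal z = volume (Icc 0 z) := by simp
            rw [this]
            exact measure_mono fun y hy => ⟨hy.2.1, le_of_lt hy.1⟩
        · refine (hind (Ici z) measurableSet_Ici fun t => ?_).trans ?_
          · by_cases ht : z ≤ t <;> simp [S, ht, hzs, not_le.1 hzs]
          · rw [← Real.volume_Icc]
            exact measure_mono fun y hy => ⟨hy.1, hy.2.2⟩

/-- Lebesgue measure on the unit cube. -/
def cubeMeasure (n : ℕ) : Measure (Fin n → ℝ) := Measure.pi fun _ => unitMeasure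

instance (n : ℕ) : IsProbabilityMeasure (cubeMeasure n) := by unfold cubeMeasure; infer_instance

lemma measurePreserving_cons (n : ℕ) :
    MeasurePreserving (fun z : ℝ × (Fin n → ℝ) => (Fin.cons z.1 z.2 : Fin (n + 1) → ℝ))
      (unitMeasure.prod (cubeMeasure n)) (cubeMeasure (n + 1)) := by
  have := (measurePreserving_piFinSuccAbove (fun _ : Fin (n + 1) => unitMeasure) 0).symm
  have e : (fun z : ℝ × (Fin n → ℝ) => (Fin.cons z.1 z.2 : Fin (n + 1) → ℝ)) =
      (MeasurableEquiv.piFinSuccAbove (fun _ => ℝ) 0).symm := by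
    ext z j
    simp [MeasurableEquiv.piFinSuccAbove]
  rw [e]
  exact this

/-- The `L^p`-Poincaré inequality on the unit cube, with constant `n / 2` for every `p`. The function
`G` bounds the absolute values of all partial derivatives. -/
theorem lintegral_sub_mean_cube_rpow_le {p : ℝ} (hp : 1 < p) (n : ℕ) :
    ∀ {f : (Fin n → ℝ) → ℝ} (_ : Continuous f) {M : ℝ} (_ : ∀ x, |f x| ≤ M)
    {G : (Fin n → ℝ) → ℝ≥0∞} (_ : Measurable G)
    (_ : ∀ x j a b, a ≤ b → ‖f (Function.update x j b) - f (Function.update x j a)‖ₑ ≤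
      ∫⁻ z in Ioc a b, G (Function.update x j z)),
    ∫⁻ x, ‖f x - ∫ y, f y ∂cubeMeasure n‖ₑ ^ p ∂cubeMeasure n
      ≤ (n / 2) ^ p * ∫⁻ x, G x ^ p ∂cubeMeasure n := by
  have hp0 : 0 < p := by linarith
  induction n with
  | zero =>
    intro f _ M _ G _ _
    have : ∀ x, f x - ∫ y, f y ∂cubeMeasure 0 = 0 := by
      intro x
      have : ∀ y, f y = f x := fun y => congrArg f (Subsingleton.elim _ _)
      simp [this]
    simp [this, hp0]
  | succ n ih =>
    intro f hf M hM G hG h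
    have hmp := measurePreserving_cons n
    have hcons : Continuous (fun z : ℝ × (Fin n → ℝ) => (Fin.cons z.1 z.2 : Fin (n + 1) → ℝ)) :=
      continuous_pi fun j => by refine Fin.cases ?_ (fun i => ?_) j <;> simp <;> fun_prop
    set F : ℝ × (Fin n → ℝ) → ℝ := fun z => f (Fin.cons z.1 z.2)
    set H : ℝ × (Fin n → ℝ) → ℝ≥0∞ := fun z => G (Fin.cons z.1 z.2)
    have hF : Continuous F := hf.comp hcons
    have hH : Measurable H := hG.comp hcons.measurable
    have hFM : ∀ z, |F z| ≤ M := fun z => hM _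
    have hFint : Integrable F (unitMeasure.prod (cubeMeasure n)) :=
      Integrable.of_bound hF.aestronglyMeasurable M (.of_forall hFM)
    have hFx : ∀ y, Integrable (fun x => F (x, y)) unitMeasure := fun y =>
      Integrable.of_bound (hF.comp (by fun_prop)).aestronglyMeasurable M (.of_forall fun x => hFM _)
    set m : (Fin n → ℝ) → ℝ := fun y => ∫ x, F (x, y) ∂unitMeasure
    set e : ℝ → ℝ := fun x => ∫ y, F (x, y) ∂cubeMeasure n
    set c : ℝ := ∫ y, f y ∂cubeMeasure (n + 1)
    have hmm : Measurable m := (hF.stronglyMeasurable.integral_prod_left).measurable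
    have hem : Measurable e := (hF.stronglyMeasurable.integral_prod_right).measurable
    have hc : c = ∫ x, e x ∂unitMeasure := by
      rw [← integral_prod _ hFint]
      have := integral_map (μ := unitMeasure.prod (cubeMeasure n)) hmp.measurable.aemeasurable
        (f := f) hf.aestronglyMeasurable
      rw [hmp.map_eq] at this
      exact this
    have hfirst : ∫⁻ z, ‖F z - m z.2‖ₑ ^ p ∂(unitMeasure.prod (cubeMeasure n))
        ≤ (1 / 2) ^ p * ∫⁻ z, H z ^ p ∂(unitMeasure.prod (cubeMeasure n)) := by
      rw [lintegral_prod_symm' _ (by fun_prop), lintegral_prod_symm' _ (by fun_prop),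
        ← lintegral_const_mul _ (by fun_prop)]
      apply lintegral_mono
      intro y
      refine lintegral_sub_mean_rpow_le hp (hFx y) (hH.comp (by fun_prop)) fun a b hab => ?_
      have := h (Fin.cons 0 y) 0 a b hab
      simpa [Fin.update_cons_zero] using this
    have hsecond : ∫⁻ z, ‖m z.2 - c‖ₑ ^ p ∂(unitMeasure.prod (cubeMeasure n))
        ≤ (n / 2) ^ p * ∫⁻ z, H z ^ p ∂(unitMeasure.prod (cubeMeasure n)) := by
      calc ∫⁻ z, ‖m z.2 - c‖ₑ ^ p ∂(unitMeasure.prod (cubeMeasure n))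
          = ∫⁻ y, ‖m y - c‖ₑ ^ p ∂cubeMeasure n := by
            rw [lintegral_prod_symm' _ (by fun_prop)]
            simp
        _ ≤ ∫⁻ y, ∫⁻ x, ‖F (x, y) - e x‖ₑ ^ p ∂unitMeasure ∂cubeMeasure n := by
            apply lintegral_mono
            intro y
            change ‖m y - c‖ₑ ^ p ≤ ∫⁻ x, ‖F (x, y) - e x‖ₑ ^ p ∂unitMeasure
            have : m y - c = ∫ x, (F (x, y) - e x) ∂unitMeasure := by
              rw [integral_sub (hFx y) hFint.integral_prod_left, hc]
            rw [this]
            refine le_trans ?_ (rpow_lintegral_le_lintegral_rpow hp (by fun_prop))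
            gcongr
            exact enorm_integral_le_lintegral_enorm _
        _ = ∫⁻ x, ∫⁻ y, ‖F (x, y) - e x‖ₑ ^ p ∂cubeMeasure n ∂unitMeasure :=
            lintegral_lintegral_swap (((hF.measurable.comp measurable_swap).sub
              (hem.comp measurable_snd)).enorm.pow_const p).aemeasurable
        _ ≤ ∫⁻ x, (n / 2) ^ p * ∫⁻ y, H (x, y) ^ p ∂cubeMeasure n ∂unitMeasure := by
            apply lintegral_mono
            intro x
            refine ih (f := fun y => F (x, y)) (hF.comp (by fun_prop)) (fun y => hFM _)
              (G := fun y => H (x, y)) (hH.comp (by fun_prop)) fun y j a b hab => ?_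
            have := h (Fin.cons x y) j.succ a b hab
            simpa [← Fin.cons_update] using this
        _ = _ := by
            rw [lintegral_const_mul _ (by fun_prop), lintegral_prod _ (by fun_prop)]
    have hsum : ∫⁻ z, ‖F z - c‖ₑ ^ p ∂(unitMeasure.prod (cubeMeasure n))
        ≤ ((n + 1 : ℕ) / 2) ^ p * ∫⁻ z, H z ^ p ∂(unitMeasure.prod (cubeMeasure n)) := by
      have hmink := ENNReal.lintegral_Lp_add_le (μ := unitMeasure.prod (cubeMeasure n)) (p := p)
        (f := fun z => ‖F z - m z.2‖ₑ) (g := fun z => ‖m z.2 - c‖ₑ)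
        (hF.measurable.sub (hmm.comp measurable_snd)).enorm.aemeasurable
        ((hmm.comp measurable_snd).sub_const c).enorm.aemeasurable hp.le
      set J := ∫⁻ z, H z ^ p ∂(unitMeasure.prod (cubeMeasure n))
      have hroot : ∀ a : ℝ≥0∞, (a ^ p * J) ^ (1 / p) = a * J ^ (1 / p) := by
        intro a
        rw [ENNReal.mul_rpow_of_nonneg _ _ (by positivity), ← ENNReal.rpow_mul,
          mul_one_div_cancel hp0.ne', ENNReal.rpow_one]
      have hle : (∫⁻ z, ‖F z - c‖ₑ ^ p ∂(unitMeasure.prod (cubeMeasure n))) ^ (1 / p) ≤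
          ((n + 1 : ℕ) / 2) * J ^ (1 / p) := by
        calc _ ≤ _ := by
              refine le_trans (ENNReal.rpow_le_rpow (lintegral_mono fun z => ?_) (by positivity)) hmink
              apply ENNReal.rpow_le_rpow _ hp0.le
              calc ‖F z - c‖ₑ = ‖(F z - m z.2) + (m z.2 - c)‖ₑ := by ring_nf
                _ ≤ _ := enorm_add_le _ _
          _ ≤ ((1 / 2) ^ p * J) ^ (1 / p) + ((n / 2) ^ p * J) ^ (1 / p) := by gcongr
          _ = _ := by
              rw [hroot, hroot, ← add_mul, ENNReal.div_add_div_same]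
              push_cast
              rw [add_comm]
      calc _ = ((∫⁻ z, ‖F z - c‖ₑ ^ p ∂(unitMeasure.prod (cubeMeasure n))) ^ (1 / p)) ^ p := by
            rw [← ENNReal.rpow_mul, one_div_mul_cancel hp0.ne', ENNReal.rpow_one]
        _ ≤ (((n + 1 : ℕ) / 2) * J ^ (1 / p)) ^ p := ENNReal.rpow_le_rpow hle hp0.le
        _ = _ := by
            rw [ENNReal.mul_rpow_of_nonneg _ _ hp0.le, ← ENNReal.rpow_mul,
              one_div_mul_cancel hp0.ne', ENNReal.rpow_one]
    rw [← hmp.lintegral_comp (f := fun x => ‖f x - c‖ₑ ^ p) (by fun_prop),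
      ← hmp.lintegral_comp (f := fun x => G x ^ p) (by fun_prop)]
    exact hsum

end UnitCube

/-! ### The sorting map from the cube onto a simplex -/

section SortMap

/-- The fundamental theorem of calculus, as an inequality, along a Lipschitz curve. -/
lemma enorm_sub_le_lintegral_fderiv_comp {E : Type*} [NormedAddCommGroup E] [NormedSpace ℝ E]
    [FiniteDimensional ℝ E] {φ : E → ℝ} (hφ : ContDiff ℝ 1 φ) {K : NNReal} (hK : LipschitzWith K φ)
    {γ : ℝ → E} {h : NNReal} (hγ : LipschitzWith h γ) {a b : ℝ} (hab : a ≤ b) :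
    ‖φ (γ b) - φ (γ a)‖ₑ ≤ ∫⁻ z in Ioc a b, h * ‖fderiv ℝ φ (γ z)‖ₑ := by
  have hL : LipschitzWith (K * h) (φ ∘ γ) := hK.comp hγ
  have hac : AbsolutelyContinuousOnInterval (φ ∘ γ) a b :=
    (hL.lipschitzOnWith (s := uIcc a b)).absolutelyContinuousOnInterval
  have hftc := hac.integral_deriv_eq_sub
  simp only [Function.comp_apply] at hftc
  rw [← hftc, intervalIntegral.integral_of_le hab]
  refine (enorm_integral_le_lintegral_enorm _).trans ?_
  apply lintegral_mono_ae
  filter_upwards [ae_restrict_of_ae hγ.ae_differentiableAt_real] with z hz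
  have hd : HasDerivAt (φ ∘ γ) (fderiv ℝ φ (γ z) (deriv γ z)) z :=
    ((hφ.differentiable one_ne_zero) (γ z)).hasFDerivAt.comp_hasDerivAt z hz.hasDerivAt
  rw [hd.deriv, mul_comm]
  refine ((fderiv ℝ φ (γ z)).le_opENorm _).trans ?_
  gcongr
  have := norm_deriv_le_of_lipschitz hγ (x₀ := z)
  rw [enorm_le_coe]
  exact this

variable {n : ℕ}

/-- The number of coordinates of `x` that exceed the level `t`. -/
def countAbove (x : Fin n → ℝ) (t : ℝ) : Fin (n + 1) :=
  ⟨(Finset.univ.filter fun j => t < x j).card, by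
    have := Finset.card_le_univ (Finset.univ.filter fun j => t < x j)
    rw [Fintype.card_fin] at this
    omega⟩

lemma measurable_countAbove (x : Fin n → ℝ) : Measurable (countAbove x) := by
  have h : Measurable fun t => (countAbove x t : ℕ) := by
    simp only [countAbove, Finset.card_filter]
    exact Finset.measurable_sum _ fun j _ =>
      Measurable.ite (measurableSet_lt measurable_id measurable_const) measurable_const
        measurable_const
  refine measurable_to_countable' fun k => ?_
  have : countAbove x ⁻¹' {k} = (fun t => (countAbove x t : ℕ)) ⁻¹' {(k : ℕ)} := by
    ext t; simp [Fin.ext_iff]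
  rw [this]
  exact h (measurableSet_singleton _)

lemma countAbove_comp_perm (x : Fin n → ℝ) (σ : Equiv.Perm (Fin n)) (t : ℝ) :
    countAbove (x ∘ σ) t = countAbove x t := by
  apply Fin.ext
  change (Finset.univ.filter fun j => t < (x ∘ σ) j).card = (Finset.univ.filter fun j => t < x j).card
  exact Finset.card_equiv σ (by simp)

lemma lt_countAbove_iff {x : Fin n → ℝ} (hx : Antitone x) (k : Fin n) (t : ℝ) :
    (k : ℕ) < countAbove x t ↔ t < x k := by
  simp only [countAbove]
  constructor
  · intro h
    by_contra hk
    have hsub : (Finset.univ.filter fun j => t < x j) ⊆ Finset.Iio k := by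
      intro j hj
      simp only [Finset.mem_filter, Finset.mem_univ, true_and, Finset.mem_Iio] at hj ⊢
      by_contra hkj
      exact hk (hj.trans_le (hx (not_lt.1 hkj)))
    have := Finset.card_le_card hsub
    rw [Fin.card_Iio] at this
    omega
  · intro h
    have hsub : Finset.Iic k ⊆ (Finset.univ.filter fun j => t < x j) := by
      intro j hj
      simp only [Finset.mem_filter, Finset.mem_univ, true_and, Finset.mem_Iic] at hj ⊢
      exact h.trans_le (hx hj)
    have := Finset.card_le_card hsub
    rw [Fin.card_Iic] at this
    omega

lemma integrable_comp_countAbove {E : Type*} [NormedAddCommGroup E] (V : Fin (n + 1) → E) (x : Fin n → ℝ) :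
    Integrable (fun t => V (countAbove x t)) unitMeasure := by
  refine Integrable.of_bound (C := ∑ k, ‖V k‖) ?_ (.of_forall fun t => ?_)
  · exact ((StronglyMeasurable.of_discrete (f := V)).comp_measurable
      (measurable_countAbove x)).aestronglyMeasurable
  · exact Finset.single_le_sum (f := fun k => ‖V k‖) (fun k _ => norm_nonneg _) (Finset.mem_univ _)

variable {E : Type*} [NormedAddCommGroup E] [NormedSpace ℝ E]

/-- The map from the unit cube to the simplex with vertices `V` that forgets the order of the
coordinates: if `x` is sorted decreasingly, it is
`V 0 + ∑ k, x k • (V (k + 1) - V k)` (see `sortMap_of_antitone`). The definition as an integral over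
levels makes the Lipschitz bound in terms of the edge lengths evident. -/
def sortMap (V : Fin (n + 1) → E) (x : Fin n → ℝ) : E :=
  ∫ t, V (countAbove x t) ∂unitMeasure

lemma sortMap_comp_perm (V : Fin (n + 1) → E) (x : Fin n → ℝ) (σ : Equiv.Perm (Fin n)) :
    sortMap V (x ∘ σ) = sortMap V x := by
  simp only [sortMap, countAbove_comp_perm]

lemma norm_sortMap_sub_le {V : Fin (n + 1) → E} {h : ℝ} (hV : ∀ i j, ‖V i - V j‖ ≤ h)
    (x y : Fin n → ℝ) : ‖sortMap V x - sortMap V y‖ ≤ h * ∑ j, |x j - y j| := by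
  have h0 : 0 ≤ h := (norm_nonneg _).trans (hV 0 0)
  unfold sortMap
  rw [← integral_sub (integrable_comp_countAbove V x) (integrable_comp_countAbove V y)]
  have hint : ∀ j, Integrable ((Ico (min (x j) (y j)) (max (x j) (y j))).indicator
      (fun _ => (1 : ℝ))) unitMeasure := fun j =>
    (integrable_const (1 : ℝ)).indicator measurableSet_Ico
  calc ‖∫ t, (V (countAbove x t) - V (countAbove y t)) ∂unitMeasure‖
      ≤ ∫ t, h * ∑ j, (Ico (min (x j) (y j)) (max (x j) (y j))).indicator (fun _ => (1 : ℝ)) t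
          ∂unitMeasure := by
        refine norm_integral_le_of_norm_le
          ((integrable_finsetSum _ fun j _ => hint j).const_mul h) (.of_forall fun t => ?_)
        have hnn : ∀ j, 0 ≤ (Ico (min (x j) (y j)) (max (x j) (y j))).indicator
            (fun _ => (1 : ℝ)) t := fun j => indicator_nonneg (fun _ _ => zero_le_one) _
        by_cases hc : countAbove x t = countAbove y t
        · rw [hc, sub_self, norm_zero]
          exact mul_nonneg h0 (Finset.sum_nonneg fun j _ => hnn j)
        · -- the counts can differ only if `t` lies between `x j` and `y j` for some `j`
          have : ∃ j, ¬ (t < x j ↔ t < y j) := by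
            by_contra hall
            push Not at hall
            apply hc
            simp only [countAbove, hall]
          obtain ⟨j, hj⟩ := this
          have hmem : t ∈ Ico (min (x j) (y j)) (max (x j) (y j)) := by
            simp only [mem_Ico, min_le_iff, lt_max_iff]
            by_cases h1 : t < x j
            · have : y j ≤ t := by by_contra h2; exact hj ⟨fun _ => not_le.1 h2, fun _ => h1⟩
              exact ⟨Or.inr this, Or.inl h1⟩
            · have : t < y j := by by_contra h2; exact hj ⟨fun h => absurd h h1, fun h => absurd h h2⟩
              exact ⟨Or.inl (not_lt.1 h1), Or.inr this⟩
          refine (hV _ _).trans (le_mul_of_one_le_right h0 ?_)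
          calc (1 : ℝ) = (Ico (min (x j) (y j)) (max (x j) (y j))).indicator (fun _ => (1 : ℝ)) t := by
                rw [indicator_of_mem hmem]
            _ ≤ _ := Finset.single_le_sum (f := fun j => (Ico (min (x j) (y j))
                (max (x j) (y j))).indicator (fun _ => (1 : ℝ)) t) (fun j _ => hnn j)
                (Finset.mem_univ j)
    _ = h * ∑ j, unitMeasure.real (Ico (min (x j) (y j)) (max (x j) (y j))) := by
        rw [integral_const_mul, integral_finsetSum _ fun j _ => hint j]
        simp [integral_indicator_const, measurableSet_Ico]
    _ ≤ _ := by
        gcongr with j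
        calc unitMeasure.real (Ico (min (x j) (y j)) (max (x j) (y j)))
            ≤ volume.real (Ico (min (x j) (y j)) (max (x j) (y j))) :=
              ENNReal.toReal_mono (by simp) (Measure.restrict_apply_le _ _)
          _ = |x j - y j| := by
              rw [Real.volume_real_Ico_of_le min_le_max, max_sub_min_eq_abs']

lemma continuous_sortMap (V : Fin (n + 1) → E) : Continuous (sortMap V) := by
  have hV : ∀ i j, ‖V i - V j‖ ≤ ∑ k, ∑ l, ‖V k - V l‖ := fun i j =>
    (Finset.single_le_sum (f := fun l => ‖V i - V l‖) (fun _ _ => norm_nonneg _)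
      (Finset.mem_univ j)).trans (Finset.single_le_sum (f := fun k => ∑ l, ‖V k - V l‖)
      (fun _ _ => Finset.sum_nonneg fun _ _ => norm_nonneg _) (Finset.mem_univ i))
  rw [continuous_iff_continuousAt]
  intro y
  rw [ContinuousAt, tendsto_iff_norm_sub_tendsto_zero]
  refine squeeze_zero (fun _ => norm_nonneg _) (fun x => norm_sortMap_sub_le hV x y) ?_
  have : Continuous fun x : Fin n → ℝ => (∑ k, ∑ l, ‖V k - V l‖) * ∑ j, |x j - y j| := by fun_prop
  simpa using this.tendsto y

lemma lipschitzWith_sortMap_update {V : Fin (n + 1) → E} {h : NNReal}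
    (hV : ∀ i j, ‖V i - V j‖ ≤ h) (x : Fin n → ℝ) (j : Fin n) :
    LipschitzWith h fun s => sortMap V (Function.update x j s) := by
  refine LipschitzWith.of_dist_le_mul fun s t => ?_
  rw [dist_eq_norm, Real.dist_eq]
  refine (norm_sortMap_sub_le hV _ _).trans_eq ?_
  rw [Finset.sum_eq_single j]
  · simp
  · intro i _ hij
    simp [hij]
  · simp

lemma sortMap_of_antitone (V : Fin (n + 1) → E) {x : Fin n → ℝ} (hx : Antitone x)
    (h0 : ∀ k, 0 ≤ x k) (h1 : ∀ k, x k ≤ 1) [CompleteSpace E] :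
    sortMap V x = V 0 + ∑ k : Fin n, x k • (V k.succ - V k.castSucc) := by
  have htel : ∀ c : Fin (n + 1), V c = V 0 + ∑ k : Fin n,
      if (k : ℕ) < c then V k.succ - V k.castSucc else 0 := by
    intro c
    induction c using Fin.induction with
    | zero => simp
    | succ i ih =>
      have : ∀ k : Fin n, (if (k : ℕ) < i.succ then V k.succ - V k.castSucc else 0) =
          (if (k : ℕ) < i.castSucc then V k.succ - V k.castSucc else 0) +
          if k = i then V k.succ - V k.castSucc else 0 := by
        intro k
        rcases lt_trichotomy k i with h | h | h
        · have h' : (k : ℕ) < i := h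
          simp [h.ne, h', h'.le]
        · simp [h]
        · have h' : (i : ℕ) < k := h
          simp [h.ne', h'.not_gt, h'.not_ge]
      rw [Finset.sum_congr rfl fun k _ => this k, Finset.sum_add_distrib, ← add_assoc, ← ih]
      simp
  have hfun : ∀ t, V (countAbove x t) = V 0 + ∑ k : Fin n,
      (Iio (x k)).indicator (fun _ => V k.succ - V k.castSucc) t := by
    intro t
    rw [htel (countAbove x t)]
    congr 1
    refine Finset.sum_congr rfl fun k _ => ?_
    simp only [lt_countAbove_iff hx k t, indicator, mem_Iio]
  have hint : ∀ k : Fin n, Integrable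
      ((Iio (x k)).indicator (fun _ => V k.succ - V k.castSucc)) unitMeasure := fun k =>
    (integrable_const _).indicator measurableSet_Iio
  unfold sortMap
  simp_rw [hfun]
  rw [integral_add (integrable_const _) (integrable_finsetSum _ fun k _ => hint k),
    integral_finsetSum _ fun k _ => hint k]
  simp only [integral_const, probReal_univ, one_smul]
  congr 1
  refine Finset.sum_congr rfl fun k _ => ?_
  rw [integral_indicator_const _ measurableSet_Iio]
  congr 1
  have : Iio (x k) ∩ Icc 0 1 = Ico 0 (x k) := by
    ext t
    simp only [mem_inter_iff, mem_Iio, mem_Icc, mem_Ico]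
    exact ⟨fun h => ⟨h.2.1, h.1⟩, fun h => ⟨h.2, h.1, h.2.le.trans (h1 k)⟩⟩
  rw [unitMeasure, measureReal_restrict_apply measurableSet_Iio, this,
    Real.volume_real_Ico_of_le (h0 k), sub_zero]

/-- The `L^p`-Poincaré inequality for a function on a simplex, pulled back to the cube by the sorting
map. -/
lemma lintegral_sub_mean_sortMap_rpow_le [FiniteDimensional ℝ E] {p : ℝ} (hp : 1 < p) {φ : E → ℝ}
    (hφ : ContDiff ℝ 1 φ) (hc : HasCompactSupport φ) {V : Fin (n + 1) → E} {h : NNReal}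
    (hV : ∀ i j, ‖V i - V j‖ ≤ h) :
    ∫⁻ x, ‖φ (sortMap V x) - ∫ y, φ (sortMap V y) ∂cubeMeasure n‖ₑ ^ p ∂cubeMeasure n
      ≤ (n / 2) ^ p * ∫⁻ x, (h * ‖fderiv ℝ φ (sortMap V x)‖ₑ) ^ p ∂cubeMeasure n := by
  obtain ⟨K, hK⟩ := hφ.lipschitzWith_of_hasCompactSupport hc one_ne_zero
  obtain ⟨M, hM⟩ := hc.exists_bound_of_continuous hφ.continuous
  have hfd : Continuous fun x => ‖fderiv ℝ φ (sortMap V x)‖ₑ :=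
    ((hφ.continuous_fderiv one_ne_zero).comp (continuous_sortMap V)).enorm
  refine lintegral_sub_mean_cube_rpow_le hp n (hφ.continuous.comp (continuous_sortMap V))
    (fun x => hM _) (hfd.measurable.const_mul _) fun x j a b hab => ?_
  exact enorm_sub_le_lintegral_fderiv_comp hφ hK (lipschitzWith_sortMap_update hV x j) hab

end SortMap

/-! ### The sorting map transports the cube to the uniform distribution on the simplex -/

section UniformDistribution

variable {n : ℕ}

/-- The Kuhn simplex: points of the unit cube with decreasing coordinates. -/
def kuhnSimplex (n : ℕ) : Set (Fin n → ℝ) := {x | Antitone x ∧ ∀ k, x k ∈ Icc (0 : ℝ) 1}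

lemma measurableSet_kuhnSimplex : MeasurableSet (kuhnSimplex n) := by
  have : kuhnSimplex n = {x : Fin n → ℝ | Antitone x} ∩ univ.pi fun _ => Icc (0 : ℝ) 1 := by
    ext x; simp [kuhnSimplex, -Set.pi_univ_Icc]
  rw [this]
  refine MeasurableSet.inter (IsClosed.measurableSet ?_)
    (MeasurableSet.univ_pi fun _ => measurableSet_Icc)
  simp only [Antitone, ofPred_forall]
  exact isClosed_iInter fun i => isClosed_iInter fun j => isClosed_iInter fun _ =>
    isClosed_le (continuous_apply j) (continuous_apply i)

lemma convex_kuhnSimplex : Convex ℝ (kuhnSimplex n) := by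
  intro x hx y hy a b ha hb hab
  refine ⟨fun i j hij => ?_, fun k => ?_⟩
  · have h1 := mul_le_mul_of_nonneg_left (hx.1 hij) ha
    have h2 := mul_le_mul_of_nonneg_left (hy.1 hij) hb
    simp only [Pi.add_apply, Pi.smul_apply, smul_eq_mul]
    linarith
  · exact (convex_Icc (0 : ℝ) 1) (hx.2 k) (hy.2 k) ha hb hab

lemma cubeMeasure_eq_restrict :
    cubeMeasure n = (volume : Measure (Fin n → ℝ)).restrict (univ.pi fun _ => Icc 0 1) := by
  rw [cubeMeasure, volume_pi, Measure.restrict_pi_pi]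
  rfl

lemma volume_setOf_eq_coord {i j : Fin n} (hij : i ≠ j) :
    volume {x : Fin n → ℝ | x i = x j} = 0 := by
  let p : (Fin n → ℝ) →ₗ[ℝ] ℝ := LinearMap.proj (R := ℝ) (φ := fun _ : Fin n => ℝ) i -
    LinearMap.proj (R := ℝ) (φ := fun _ : Fin n => ℝ) j
  have : {x : Fin n → ℝ | x i = x j} = (LinearMap.ker p : Set (Fin n → ℝ)) := by
    ext x; simp [p, sub_eq_zero]
  rw [this]
  refine Measure.addHaar_submodule _ _ fun h => ?_
  have h1 : (Pi.single i (1 : ℝ) : Fin n → ℝ) ∈ LinearMap.ker p := by rw [h]; trivial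
  simp [p, hij.symm] at h1

/-- The cube is, up to null sets, the disjoint union of the images of the Kuhn simplex under the
permutations of the coordinates. -/
lemma cubeMeasure_eq_sum :
    cubeMeasure n = Measure.sum fun σ : Equiv.Perm (Fin n) =>
      (volume : Measure (Fin n → ℝ)).restrict ((fun x => x ∘ σ) ⁻¹' kuhnSimplex n) := by
  have hmeas : ∀ σ : Equiv.Perm (Fin n), MeasurableSet ((fun x => x ∘ σ) ⁻¹' kuhnSimplex n) :=
    fun σ => (measurable_pi_lambda _ fun j => measurable_pi_apply (σ j)) measurableSet_kuhnSimplex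
  rw [← Measure.restrict_iUnion_ae _ fun σ => (hmeas σ).nullMeasurableSet, cubeMeasure_eq_restrict]
  · congr 1
    ext x
    simp only [Set.mem_pi, mem_univ, true_implies, mem_iUnion, mem_preimage, kuhnSimplex, mem_ofPred_eq]
    constructor
    · intro h
      refine ⟨Fin.revPerm.trans (Tuple.sort x), ?_, fun k => h _⟩
      intro i j hij
      exact Tuple.monotone_sort x (Fin.rev_le_rev.2 hij)
    · rintro ⟨σ, -, h⟩ k
      simpa using h (σ.symm k)
  · intro σ τ hστ
    refine measure_mono_null (t := ⋃ i, ⋃ j, ⋃ (_ : i ≠ j), {x : Fin n → ℝ | x i = x j}) ?_ ?_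
    · rintro x ⟨hσ, hτ⟩
      by_contra hx
      apply hστ
      have hinj : Function.Injective x := by
        intro i j hij
        by_contra hne
        exact hx (mem_iUnion.2 ⟨i, mem_iUnion.2 ⟨j, mem_iUnion.2 ⟨hne, hij⟩⟩⟩)
      have := Tuple.unique_antitone hσ.1 hτ.1
      ext1 k
      exact hinj (congrFun this k)
    · simp only [measure_iUnion_null_iff]
      exact fun i j hij => volume_setOf_eq_coord hij

variable {E : Type*} [NormedAddCommGroup E] [NormedSpace ℝ E]

/-- The linear map that takes the standard basis to the successive edges of a simplex. -/
def edgeMap (V : Fin (n + 1) → E) : (Fin n → ℝ) →ₗ[ℝ] E :=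
  Fintype.linearCombination ℝ fun k : Fin n => V k.succ - V k.castSucc

lemma edgeMap_apply (V : Fin (n + 1) → E) (x : Fin n → ℝ) :
    edgeMap V x = ∑ k : Fin n, x k • (V k.succ - V k.castSucc) :=
  Fintype.linearCombination_apply ..

lemma edgeMap_injective {V : Fin (n + 1) → E} (hV : AffineIndependent ℝ V) :
    Function.Injective (edgeMap V) := by
  rw [injective_iff_map_eq_zero]
  intro x hx
  rw [edgeMap_apply] at hx
  -- the barycentric weights of `edgeMap V x`
  set w : Fin (n + 1) → ℝ := fun i =>
    (Fin.cons 0 x : Fin (n + 1) → ℝ) i - (Fin.snoc x 0 : Fin (n + 1) → ℝ) i with hw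
  have h1 : ∑ i, w i = 0 := by
    simp only [hw, Finset.sum_sub_distrib]
    rw [Fin.sum_univ_succ, Fin.sum_univ_castSucc (fun i => (Fin.snoc x 0 : Fin (n + 1) → ℝ) i)]
    simp
  have h2 : ∑ i, w i • V i = 0 := by
    simp only [hw, sub_smul, Finset.sum_sub_distrib]
    rw [Fin.sum_univ_succ, Fin.sum_univ_castSucc (fun i => (Fin.snoc x 0 : Fin (n + 1) → ℝ) i • V i)]
    simp only [Fin.cons_zero, Fin.cons_succ, Fin.snoc_castSucc, Fin.snoc_last, zero_smul, zero_add,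
      add_zero]
    rw [← hx, ← Finset.sum_sub_distrib]
    simp only [smul_sub]
  have h3 := fun i => (affineIndependent_iff.1 hV Finset.univ w h1 h2) i (Finset.mem_univ i)
  have h4 : ∀ m : ℕ, ∀ k : Fin n, (k : ℕ) = m → x k = 0 := by
    intro m
    induction m with
    | zero =>
      intro k hk
      have h := h3 k.castSucc
      have e : k.castSucc = 0 := Fin.ext (by simpa using hk)
      simp only [hw, Fin.snoc_castSucc] at h
      rw [e, Fin.cons_zero] at h
      linarith
    | succ m ih =>
      intro k hk
      have h := h3 k.castSucc
      let j : Fin n := ⟨m, by omega⟩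
      have e : k.castSucc = j.succ := Fin.ext (by simpa [j] using hk)
      simp only [hw, Fin.snoc_castSucc] at h
      rw [e, Fin.cons_succ, ih j rfl] at h
      linarith
  exact funext fun k => h4 k k rfl

lemma sortMap_eq_edgeMap [CompleteSpace E] (V : Fin (n + 1) → E) {x : Fin n → ℝ}
    (hx : x ∈ kuhnSimplex n) : sortMap V x = V 0 + edgeMap V x := by
  rw [sortMap_of_antitone V hx.1 (fun k => (hx.2 k).1) (fun k => (hx.2 k).2), edgeMap_apply]

lemma sortMap_mem_convexHull [CompleteSpace E] (V : Fin (n + 1) → E) (x : Fin n → ℝ) :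
    sortMap V x ∈ convexHull ℝ (range V) :=
  (convex_convexHull ℝ _).integral_mem ((finite_range V).isCompact_convexHull ℝ).isClosed
    (.of_forall fun _ => subset_convexHull ℝ _ (mem_range_self _)) (integrable_comp_countAbove V x)

/-- The affine map with linear part `edgeMap V` maps the Kuhn simplex onto the simplex. -/
lemma preimage_convexHull_eq_kuhnSimplex [CompleteSpace E] {V : Fin (n + 1) → E}
    (hV : AffineIndependent ℝ V) :
    (fun x => V 0 + edgeMap V x) ⁻¹' convexHull ℝ (range V) = kuhnSimplex n := by
  have hinj : Function.Injective fun x => V 0 + edgeMap V x :=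
    (add_right_injective (V 0)).comp (edgeMap_injective hV)
  have himage : convexHull ℝ (range V) ⊆ (fun x => V 0 + edgeMap V x) '' kuhnSimplex n := by
    refine convexHull_min ?_ ?_
    · rintro _ ⟨i, rfl⟩
      have hmem : (fun k : Fin n => if (k : ℕ) < i then (1 : ℝ) else 0) ∈ kuhnSimplex n := by
        refine ⟨fun a b hab => ?_, fun k => ?_⟩
        · have hab' : (a : ℕ) ≤ b := hab
          dsimp only
          split_ifs <;> first | omega | norm_num
        · dsimp only
          split_ifs <;> norm_num
      refine ⟨_, hmem, ?_⟩
      dsimp only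
      rw [edgeMap_apply]
      clear hmem hinj hV
      induction i using Fin.induction with
      | zero => simp
      | succ i ih =>
        have : ∀ k : Fin n, (if (k : ℕ) < i.succ then (1 : ℝ) else 0) =
            (if (k : ℕ) < i.castSucc then 1 else 0) + if k = i then 1 else 0 := by
          intro k
          rcases lt_trichotomy k i with h | h | h
          · have h' : (k : ℕ) < i := h
            simp [h.ne, h', h'.le]
          · simp [h]
          · have h' : (i : ℕ) < k := h
            simp [h.ne', h'.not_gt, h'.not_ge]
        simp only [this, add_smul, Finset.sum_add_distrib]
        rw [← add_assoc, ih]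
        simp
    · have := (convex_kuhnSimplex (n := n)).linear_image (edgeMap V)
      have := this.translate (V 0)
      rwa [image_image] at this
  ext x
  constructor
  · intro hx
    obtain ⟨y, hy, hyx⟩ := himage hx
    rwa [← hinj hyx]
  · intro hx
    rw [mem_preimage, ← sortMap_eq_edgeMap V hx]
    exact sortMap_mem_convexHull V x

variable [MeasurableSpace E] [BorelSpace E] [FiniteDimensional ℝ E]

/-- The sorting map transports Lebesgue measure on the unit cube to the uniform distribution on the
simplex. -/
theorem map_sortMap_cubeMeasure (μ : Measure E) [μ.IsAddHaarMeasure]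
    (hn : Module.finrank ℝ E = n) {V : Fin (n + 1) → E} (hV : AffineIndependent ℝ V) :
    (cubeMeasure n).map (sortMap V) =
      (μ (convexHull ℝ (range V)))⁻¹ • μ.restrict (convexHull ℝ (range V)) := by
  have hΦ : Measurable (sortMap V) := (continuous_sortMap V).measurable
  set T := convexHull ℝ (range V) with hT
  have hTm : MeasurableSet T := ((finite_range V).isCompact_convexHull ℝ).isClosed.measurableSet
  let L : (Fin n → ℝ) ≃ₗ[ℝ] E :=
    LinearEquiv.ofInjectiveOfFinrankEq (edgeMap V) (edgeMap_injective hV) (by simp [hn])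
  have hL : ∀ x, L x = edgeMap V x := fun x => rfl
  let A : (Fin n → ℝ) ≃ᵐ E :=
    L.toContinuousLinearEquiv.toHomeomorph.toMeasurableEquiv.trans (MeasurableEquiv.addLeft (V 0))
  have hA : ∀ x, A x = V 0 + edgeMap V x := fun x => rfl
  obtain ⟨c, hc⟩ : ∃ c : ℝ≥0∞, (volume : Measure (Fin n → ℝ)).map A = c • μ := by
    have hcomp : (A : (Fin n → ℝ) → E) = (fun y => V 0 + y) ∘ L.toContinuousLinearEquiv := rfl
    have : ((volume : Measure (Fin n → ℝ)).map L.toContinuousLinearEquiv).IsAddHaarMeasure :=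
      L.toContinuousLinearEquiv.isAddHaarMeasure_map _
    rw [hcomp, ← Measure.map_map (by fun_prop) L.toContinuousLinearEquiv.continuous.measurable,
      map_add_left_eq_self]
    exact ⟨_, Measure.isAddLeftInvariant_eq_smul _ μ⟩
  have hK : ((volume : Measure (Fin n → ℝ)).restrict (kuhnSimplex n)).map (sortMap V) =
      c • μ.restrict T := by
    have h1 : ((volume : Measure (Fin n → ℝ)).restrict (kuhnSimplex n)).map (sortMap V) =
        ((volume : Measure (Fin n → ℝ)).restrict (kuhnSimplex n)).map A := by
      apply Measure.map_congr
      filter_upwards [ae_restrict_mem measurableSet_kuhnSimplex] with x hx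
      rw [hA, sortMap_eq_edgeMap V hx]
    rw [h1, ← preimage_convexHull_eq_kuhnSimplex hV]
    have h2 := A.measurableEmbedding.restrict_map volume T
    rw [hc, Measure.restrict_smul] at h2
    exact h2.symm
  have hperm : ∀ σ : Equiv.Perm (Fin n), ((volume : Measure (Fin n → ℝ)).restrict
      ((fun x => x ∘ σ) ⁻¹' kuhnSimplex n)).map (sortMap V) = c • μ.restrict T := by
    intro σ
    have hmp : MeasurePreserving (fun x : Fin n → ℝ => x ∘ σ) volume volume := by
      have := (volume_measurePreserving_piCongrLeft (fun _ : Fin n => ℝ) σ.symm)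
      convert this using 1
      ext x j
      simp [MeasurableEquiv.piCongrLeft, Equiv.piCongrLeft, Equiv.piCongrLeft']
    have hmp' := hmp.restrict_preimage measurableSet_kuhnSimplex
    have : sortMap V = sortMap V ∘ fun x => x ∘ σ := by
      ext1 x; exact (sortMap_comp_perm V x σ).symm
    rw [this, ← Measure.map_map hΦ hmp.measurable, hmp'.map_eq, hK]
  obtain ⟨C, hC⟩ : ∃ C : ℝ≥0∞, (cubeMeasure n).map (sortMap V) = C • μ.restrict T := by
    refine ⟨∑ _σ : Equiv.Perm (Fin n), c, ?_⟩
    rw [cubeMeasure_eq_sum, Measure.map_sum hΦ.aemeasurable]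
    simp only [hperm]
    rw [Measure.sum_fintype, Finset.sum_smul]
  have hprob : IsProbabilityMeasure ((cubeMeasure n).map (sortMap V)) :=
    Measure.isProbabilityMeasure_map hΦ.aemeasurable
  have hone := hprob.measure_univ
  rw [hC, Measure.smul_apply, Measure.restrict_apply_univ, smul_eq_mul] at hone
  rw [hC, ENNReal.eq_inv_of_mul_eq_one_left hone]

end UniformDistribution

/-! ### The divergence theorem on a cone -/

section Cone

open scoped Pointwise

/-- Integration by parts along a ray, for the vector field that points away from the apex. -/
lemma integral_ray_eq {E : Type*} [NormedAddCommGroup E] [NormedSpace ℝ E] {ψ : E → ℝ}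
    (hψ : ContDiff ℝ 1 ψ) (P v : E) (m : ℕ) :
    ∫ s in (0 : ℝ)..1, s ^ m * ((m + 1) * ψ (P + s • v) + fderiv ℝ ψ (P + s • v) (s • v))
      = ψ (P + v) := by
  have hd : ∀ s : ℝ, HasDerivAt (fun s : ℝ => s ^ (m + 1) * ψ (P + s • v))
      (s ^ m * ((m + 1) * ψ (P + s • v) + fderiv ℝ ψ (P + s • v) (s • v))) s := by
    intro s
    have h1 : HasDerivAt (fun s : ℝ => P + s • v) v s := by
      simpa using ((hasDerivAt_id s).smul_const v).const_add P
    have h2 := ((hψ.differentiable one_ne_zero) (P + s • v)).hasFDerivAt.comp_hasDerivAt s h1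
    refine HasDerivAt.congr_deriv ((hasDerivAt_pow (m + 1) s).mul h2) ?_
    rw [map_smul, smul_eq_mul]
    push_cast
    ring
  rw [intervalIntegral.integral_eq_sub_of_hasDerivAt (fun s _ => hd s)]
  · simp
  · apply Continuous.intervalIntegrable
    have h1 := hψ.continuous
    have h2 : Continuous fun s : ℝ => fderiv ℝ ψ (P + s • v) (s • v) :=
      ((hψ.continuous_fderiv one_ne_zero).comp (by fun_prop : Continuous fun s : ℝ => P + s • v)).clm_apply
        (by fun_prop)
    fun_prop

variable {E : Type*} [NormedAddCommGroup E] [NormedSpace ℝ E] [FiniteDimensional ℝ E]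
  [MeasurableSpace E] [BorelSpace E]

/-- The divergence theorem for the vector field `ψ(y) (y - P)` on the cone with apex `P` over the
set `P + e + C`, where `C` lies in a hyperplane `W` through the origin that does not contain `e`:
only the base of the cone contributes to the flux. -/
theorem integral_cone_eq (μ : Measure E) [μ.IsAddHaarMeasure] (W : Submodule ℝ E)
    (lam : Measure W) [lam.IsAddHaarMeasure] {m : ℕ} (hm : Module.finrank ℝ W = m)
    (hmE : Module.finrank ℝ E = m + 1) {e : E} (he : e ∉ W) (P : E) {C : Set W}
    (hC : IsCompact C) :
    ∃ c : ℝ, c ≠ 0 ∧ ∀ ψ : E → ℝ, ContDiff ℝ 1 ψ →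
      ∫ y in {y | ∃ s ∈ Icc (0 : ℝ) 1, ∃ w ∈ C, y = P + s • (e + (w : E))},
        ((m + 1) * ψ y + fderiv ℝ ψ y (y - P)) ∂μ = c * ∫ w in C, ψ (P + (e + (w : E))) ∂lam := by
  set S := {y | ∃ s ∈ Icc (0 : ℝ) 1, ∃ w ∈ C, y = P + s • (e + (w : E))} with hS
  let L₀ : (ℝ × W) →ₗ[ℝ] E := (LinearMap.toSpanSingleton ℝ E e).coprod W.subtype
  have hL₀ : ∀ s w, L₀ (s, w) = s • e + (w : E) := fun s w => by simp [L₀]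
  have hinj₀ : Function.Injective L₀ := by
    rw [injective_iff_map_eq_zero]
    rintro ⟨s, w⟩ h
    rw [hL₀] at h
    have hs : s = 0 := by
      by_contra hs
      apply he
      have : e = (-s⁻¹) • (w : E) := by
        have h' : s • e = -(w : E) := eq_neg_of_add_eq_zero_left h
        rw [neg_smul, ← smul_neg, ← h', smul_smul, inv_mul_cancel₀ hs, one_smul]
      rw [this]
      exact W.smul_mem _ w.2
    rw [hs, zero_smul, zero_add] at h
    rw [hs, Prod.mk_eq_zero]
    exact ⟨rfl, Subtype.ext h⟩
  let L : (ℝ × W) ≃ₗ[ℝ] E := LinearEquiv.ofInjectiveOfFinrankEq L₀ hinj₀ (by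
    rw [Module.finrank_prod, hm, hmE, Module.finrank_self, add_comm])
  let A : (ℝ × W) ≃ᵐ E :=
    L.toContinuousLinearEquiv.toHomeomorph.toMeasurableEquiv.trans (MeasurableEquiv.addLeft P)
  have hA : ∀ s w, A (s, w) = P + (s • e + (w : E)) := fun s w => by
    rw [← hL₀]; rfl
  have hAc : Continuous A := (continuous_const_add P).comp L.toContinuousLinearEquiv.continuous
  have hAinj := A.injective
  obtain ⟨c, hc0, hctop, hc⟩ : ∃ c : ℝ≥0∞, c ≠ 0 ∧ c ≠ ⊤ ∧
      μ = c • ((volume : Measure ℝ).prod lam).map A := by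
    have hcomp : (A : (ℝ × W) → E) = (fun y => P + y) ∘ L.toContinuousLinearEquiv := rfl
    have : (((volume : Measure ℝ).prod lam).map L.toContinuousLinearEquiv).IsAddHaarMeasure :=
      L.toContinuousLinearEquiv.isAddHaarMeasure_map _
    rw [hcomp, ← Measure.map_map (by fun_prop) L.toContinuousLinearEquiv.continuous.measurable,
      map_add_left_eq_self]
    refine ⟨_, ?_, ?_, Measure.isAddLeftInvariant_eq_smul μ _⟩
    · exact_mod_cast (Measure.addHaarScalarFactor_pos_of_isAddHaarMeasure _ _).ne'
    · exact ENNReal.coe_ne_top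
  refine ⟨c.toReal, (ENNReal.toReal_pos hc0 hctop).ne', fun ψ hψ => ?_⟩
  set g : E → ℝ := fun y => (m + 1) * ψ y + fderiv ℝ ψ y (y - P) with hg
  have hgc : Continuous g := by
    have h1 := hψ.continuous
    have h2 : Continuous fun y => fderiv ℝ ψ y (y - P) :=
      (hψ.continuous_fderiv one_ne_zero).clm_apply (by fun_prop)
    fun_prop
  have hScompact : IsCompact S := by
    have : S = (fun z : ℝ × W => P + z.1 • (e + (z.2 : E))) '' (Icc (0 : ℝ) 1 ×ˢ C) := by
      ext y
      simp only [hS, mem_ofPred_eq, mem_image, Prod.exists, mem_prod]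
      constructor
      · rintro ⟨s, hs, w, hw, rfl⟩; exact ⟨s, w, ⟨hs, hw⟩, rfl⟩
      · rintro ⟨s, w, ⟨hs, hw⟩, rfl⟩; exact ⟨s, hs, w, hw, rfl⟩
    rw [this]
    exact (isCompact_Icc.prod hC).image (by fun_prop)
  have hSm : MeasurableSet S := hScompact.isClosed.measurableSet
  have hpre : ∀ s w, A (s, w) ∈ S ↔ s ∈ Icc (0 : ℝ) 1 ∧ ∃ u ∈ C, w = s • u := by
    intro s w
    constructor
    · rintro ⟨r, hr, u, hu, h⟩
      have : A (s, w) = A (r, r • u) := by rw [h, hA]; simp [smul_add]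
      obtain ⟨rfl, rfl⟩ := Prod.mk.inj (hAinj this)
      exact ⟨hr, u, hu, rfl⟩
    · rintro ⟨hs, u, hu, rfl⟩
      exact ⟨s, hs, u, hu, by rw [hA]; simp [smul_add]⟩
  have hcompactPre : IsCompact (A ⁻¹' S) := by
    have : A ⁻¹' S = A.symm '' S := by rw [MeasurableEquiv.image_symm]
    rw [this]
    exact hScompact.image (L.toContinuousLinearEquiv.symm.continuous.comp
      (continuous_const_add (-P)))
  have hslice : ∀ s ∈ Ioc (0 : ℝ) 1, ∫ w, (A ⁻¹' S).indicator (fun z => g (A z)) (s, w) ∂lam =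
      s ^ m * ∫ u in C, g (P + s • (e + (u : E))) ∂lam := by
    intro s hs
    have h1 : ∫ w, (A ⁻¹' S).indicator (fun z => g (A z)) (s, w) ∂lam =
        ∫ w in s • C, g (A (s, w)) ∂lam := by
      rw [← integral_indicator (hC.smul s).isClosed.measurableSet]
      congr with w
      have : (s, w) ∈ A ⁻¹' S ↔ w ∈ s • C := by
        rw [mem_preimage, hpre]
        constructor
        · rintro ⟨-, u, hu, rfl⟩; exact smul_mem_smul_set hu
        · rintro ⟨u, hu, rfl⟩; exact ⟨⟨hs.1.le, hs.2⟩, u, hu, rfl⟩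
      by_cases h : w ∈ s • C
      · rw [indicator_of_mem h, indicator_of_mem (this.2 h)]
      · rw [indicator_of_notMem h, indicator_of_notMem (fun h' => h (this.1 h'))]
    have h2 := Measure.setIntegral_comp_smul_of_pos lam (fun w => g (A (s, w))) C hs.1
    rw [hm] at h2
    have hpow : s ^ m ≠ 0 := (pow_pos hs.1 m).ne'
    rw [h1]
    have h3 : ∫ u in C, g (P + s • (e + (u : E))) ∂lam = ∫ u in C, g (A (s, s • u)) ∂lam := by
      simp only [hA, smul_add, Submodule.coe_smul]
    rw [h3, h2, smul_eq_mul, ← mul_assoc, mul_inv_cancel₀ hpow, one_mul]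
  have hswap : Integrable (Function.uncurry fun (s : ℝ) (u : W) =>
      s ^ m * g (P + s • (e + (u : E)))) ((volume.restrict (Ioc (0 : ℝ) 1)).prod (lam.restrict C)) := by
    rw [Measure.prod_restrict]
    have hcont : Continuous (Function.uncurry fun (s : ℝ) (u : W) =>
        s ^ m * g (P + s • (e + (u : E)))) := by
      unfold Function.uncurry
      fun_prop
    exact (hcont.continuousOn.integrableOn_compact (isCompact_Icc.prod hC)).mono_set
      (prod_mono_left Ioc_subset_Icc_self)
  have hcint : Integrable ((A ⁻¹' S).indicator fun z => g (A z)) ((volume : Measure ℝ).prod lam) := by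
    rw [integrable_indicator_iff (A.measurable hSm)]
    exact (hgc.comp hAc).continuousOn.integrableOn_compact hcompactPre
  calc ∫ y in S, g y ∂μ
      = c.toReal * ∫ z in A ⁻¹' S, g (A z) ∂((volume : Measure ℝ).prod lam) := by
        rw [hc, Measure.restrict_smul, integral_smul_measure, smul_eq_mul,
          A.measurableEmbedding.setIntegral_map]
    _ = c.toReal * ∫ s, ∫ w, (A ⁻¹' S).indicator (fun z => g (A z)) (s, w) ∂lam := by
        rw [← integral_indicator (A.measurable hSm), integral_prod _ hcint]
    _ = c.toReal * ∫ s in Ioc (0 : ℝ) 1, ∫ w, (A ⁻¹' S).indicator (fun z => g (A z)) (s, w) ∂lam := by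
        congr 1
        rw [← integral_Icc_eq_integral_Ioc, setIntegral_eq_integral_of_forall_compl_eq_zero]
        intro s hs
        have : ∀ w, (A ⁻¹' S).indicator (fun z => g (A z)) (s, w) = 0 := fun w =>
          indicator_of_notMem (fun h => hs ((hpre s w).1 h).1) _
        simp [this]
    _ = c.toReal * ∫ s in Ioc (0 : ℝ) 1, ∫ u in C, s ^ m * g (P + s • (e + (u : E))) ∂lam := by
        congr 1
        refine setIntegral_congr_fun measurableSet_Ioc fun s hs => ?_
        rw [hslice s hs, integral_const_mul]
    _ = c.toReal * ∫ u in C, (∫ s in Ioc (0 : ℝ) 1, s ^ m * g (P + s • (e + (u : E)))) ∂lam := by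
        rw [integral_integral_swap hswap]
    _ = c.toReal * ∫ u in C, ψ (P + (e + (u : E))) ∂lam := by
        congr 2
        ext u
        rw [← integral_ray_eq hψ P (e + (u : E)) m, intervalIntegral.integral_of_le zero_le_one]
        simp only [hg, add_sub_cancel_left]

/-- The divergence theorem for the vector field `ψ(y) (y - P)` on a simplex with vertex `P`, with
Hausdorff measure on the opposite facet, which is finite. -/
theorem integral_simplex_eq_facet (μ : Measure E) [μ.IsAddHaarMeasure] {F : Finset E} {P : E}
    (hP : P ∉ F) (hind : AffineIndependent ℝ ((↑) : (insert P (F : Set E) : Set E) → E)) {m : ℕ}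
    (hF : F.card = m + 1) (hmE : Module.finrank ℝ E = m + 1) :
    μH[m] (convexHull ℝ (F : Set E)) < ⊤ ∧ ∃ c : ℝ, c ≠ 0 ∧ ∀ ψ : E → ℝ, ContDiff ℝ 1 ψ →
      ∫ y in convexHull ℝ (insert P (F : Set E)), ((m + 1) * ψ y + fderiv ℝ ψ y (y - P)) ∂μ =
        c * ∫ y in convexHull ℝ (F : Set E), ψ y ∂μH[m] := by
  obtain ⟨z, hz⟩ : F.Nonempty := Finset.card_pos.1 (by omega)
  have hindF : AffineIndependent ℝ ((↑) : ↥(F : Set E) → E) := hind.mono (subset_insert _ _)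
  set W := vectorSpan ℝ (F : Set E) with hW
  have hWm : Module.finrank ℝ W = m := by
    have := hindF.finrank_vectorSpan (n := m) (by simpa using hF)
    rwa [Subtype.range_coe] at this
  have hPspan : P ∉ affineSpan ℝ (F : Set E) := by
    have := hind.notMem_affineSpan_sdiff ⟨P, mem_insert _ _⟩ univ
    have e : ((↑) : ↥(insert P (F : Set E)) → E) '' (univ \ {⟨P, mem_insert _ _⟩}) = F := by
      ext y
      simp only [mem_image, Set.mem_sdiff, mem_univ, true_and, mem_singleton_iff, Subtype.exists,
        exists_and_right, exists_eq_right, Subtype.mk.injEq, mem_insert_iff, exists_prop]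
      constructor
      · rintro ⟨h1, h2⟩; tauto
      · intro h; exact ⟨Or.inr h, fun h' => hP (by rw [← h']; exact h)⟩
    rwa [e] at this
  have hzspan : z ∈ affineSpan ℝ (F : Set E) := subset_affineSpan _ _ hz
  have he : z - P ∉ W := by
    intro h
    apply hPspan
    have : P = -(z - P) +ᵥ z := by simp
    rw [this]
    exact AffineSubspace.vadd_mem_of_mem_direction
      (by rw [direction_affineSpan]; exact W.neg_mem h) hzspan
  let ι : W → E := fun w => P + (z - P + (w : E))
  have hι : ∀ w : W, ι w = z + w := fun w => by simp only [ι]; abel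
  have hιiso : Isometry ι := Isometry.of_dist_eq fun w w' => by
    rw [hι, hι, dist_add_left]; rfl
  have hTcompact : IsCompact (convexHull ℝ (F : Set E)) := F.finite_toSet.isCompact_convexHull ℝ
  have hFrange : convexHull ℝ (F : Set E) ⊆ range ι := by
    intro y hy
    have hy' := convexHull_subset_affineSpan _ hy
    refine ⟨⟨y - z, ?_⟩, by rw [hι]; simp⟩
    rw [hW, ← direction_affineSpan]
    exact AffineSubspace.vsub_mem_direction hy' hzspan
  have hC : IsCompact (ι ⁻¹' convexHull ℝ (F : Set E)) :=
    hιiso.isClosedEmbedding.isCompact_preimage hTcompact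
  have hlam : (μH[(m : ℝ)] : Measure W).IsAddHaarMeasure := by
    rw [← hWm]; exact isAddHaarMeasure_hausdorffMeasure
  obtain ⟨c, hc, h⟩ := integral_cone_eq μ W μH[(m : ℝ)] hWm hmE he P hC
  have hfin : μH[m] (convexHull ℝ (F : Set E)) < ⊤ := by
    rw [← inter_eq_left.2 hFrange, ← hιiso.hausdorffMeasure_preimage (Or.inl (Nat.cast_nonneg m))]
    exact hC.measure_lt_top
  refine ⟨hfin, c, hc, fun ψ hψ => ?_⟩
  have hcone : convexHull ℝ (insert P (F : Set E)) = {y | ∃ s ∈ Icc (0 : ℝ) 1,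
      ∃ w ∈ ι ⁻¹' convexHull ℝ (F : Set E), y = P + s • (z - P + (w : E))} := by
    rw [convexHull_insert ⟨z, hz⟩]
    ext y
    simp only [mem_convexJoin, mem_singleton_iff, exists_eq_left, segment_eq_image', mem_image,
      mem_ofPred_eq]
    constructor
    · rintro ⟨q, hq, s, hs, rfl⟩
      obtain ⟨w, rfl⟩ := hFrange hq
      exact ⟨s, hs, w, hq, by simp [ι]⟩
    · rintro ⟨s, hs, w, hw, rfl⟩
      exact ⟨ι w, hw, s, hs, by simp [ι]⟩
  have hfacet : ∫ y in convexHull ℝ (F : Set E), ψ y ∂μH[m] =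
      ∫ w in ι ⁻¹' convexHull ℝ (F : Set E), ψ (ι w) ∂μH[m] := by
    rw [← hιiso.isClosedEmbedding.measurableEmbedding.setIntegral_map,
      hιiso.map_hausdorffMeasure (Or.inl (Nat.cast_nonneg m)),
      Measure.restrict_restrict hTcompact.isClosed.measurableSet, inter_eq_left.2 hFrange]
  rw [hcone, h ψ hψ, hfacet]

end Cone

/-! ### The Crouzeix–Raviart interpolant on one simplex -/

section Interpolant

/-- The uniform probability distribution on a set of positive finite measure. -/
def uniformMeasure {X : Type*} [MeasurableSpace X] (μ : Measure X) (T : Set X) : Measure X := (μ T)⁻¹ • μ.restrict T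

section uniformMeasure

variable {X : Type*} [TopologicalSpace X] [MeasurableSpace X]

lemma integrable_uniformMeasure [OpensMeasurableSpace X] [T2Space X] {F : Type*} [NormedAddCommGroup F] {μ : Measure X}
    [IsFiniteMeasureOnCompacts μ] {T : Set X} (hT : IsCompact T) (h0 : μ T ≠ 0) {f : X → F}
    (hf : Continuous f) : Integrable f (uniformMeasure μ T) :=
  (hf.continuousOn.integrableOn_compact hT).smul_measure (ENNReal.inv_ne_top.2 h0)

lemma isProbabilityMeasure_uniformMeasure {μ : Measure X} [IsFiniteMeasureOnCompacts μ] {T : Set X}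
    (hT : IsCompact T) (h0 : μ T ≠ 0) : IsProbabilityMeasure (uniformMeasure μ T) := by
  constructor
  rw [uniformMeasure, Measure.smul_apply, Measure.restrict_apply_univ, smul_eq_mul,
    ENNReal.inv_mul_cancel h0 hT.measure_lt_top.ne]

lemma smul_uniformMeasure {μ : Measure X} [IsFiniteMeasureOnCompacts μ] {T : Set X}
    (hT : IsCompact T) (h0 : μ T ≠ 0) : μ T • uniformMeasure μ T = μ.restrict T := by
  rw [uniformMeasure, smul_smul, ENNReal.mul_inv_cancel h0 hT.measure_lt_top.ne, one_smul]

end uniformMeasure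

variable {E : Type*} [NormedAddCommGroup E] [NormedSpace ℝ E] [MeasurableSpace E]

/-- The barycenter of a distribution. -/
def barycenter (U : Measure E) : E := ∫ y, y ∂U

/-- The Crouzeix–Raviart interpolant of `φ` on an `n`-simplex with uniform distribution `U`: the
affine function that has the same mean as `φ` on each facet. Its gradient is the mean of the gradient
of `φ`, and its value at the barycenter `b` is the mean of `φ(y) + (1/n) ∇φ(y) ⬝ (y - b)`. -/
def crInterpolant (n : ℕ) (U : Measure E) (φ : E → ℝ) : E →ᵃ[ℝ] ℝ :=
  AffineMap.const ℝ E (∫ y, φ y ∂U + (n : ℝ)⁻¹ * ∫ y, fderiv ℝ φ y (y - barycenter U) ∂U -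
    (∫ y, fderiv ℝ φ y ∂U) (barycenter U)) + (∫ y, fderiv ℝ φ y ∂U).toLinearMap.toAffineMap

lemma crInterpolant_apply (n : ℕ) (U : Measure E) (φ : E → ℝ) (x : E) :
    crInterpolant n U φ x = ∫ y, φ y ∂U + (n : ℝ)⁻¹ * ∫ y, fderiv ℝ φ y (y - barycenter U) ∂U +
      (∫ y, fderiv ℝ φ y ∂U) (x - barycenter U) := by
  simp only [crInterpolant, AffineMap.coe_add, AffineMap.coe_const, Pi.add_apply,
    Function.const_apply, LinearMap.coe_toAffineMap, ContinuousLinearMap.coe_coe, map_sub]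
  ring

lemma hasFDerivAt_crInterpolant (n : ℕ) (U : Measure E) (φ : E → ℝ) (x : E) :
    HasFDerivAt (fun y => crInterpolant n U φ y) (∫ y, fderiv ℝ φ y ∂U) x := by
  simp only [crInterpolant_apply]
  have := ((∫ y, fderiv ℝ φ y ∂U).hasFDerivAt.comp x ((hasFDerivAt_id x).sub_const
    (barycenter U))).const_add
    (∫ y, φ y ∂U + (n : ℝ)⁻¹ * ∫ y, fderiv ℝ φ y (y - barycenter U) ∂U)
  simpa using this

variable [BorelSpace E]

/-- Jensen's inequality: the gradient of the interpolant is no larger in `L^p` than that of `φ`. -/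
theorem mul_enorm_integral_fderiv_rpow_le (μ : Measure E) [IsFiniteMeasureOnCompacts μ]
    {T : Set E} (hT : IsCompact T) (h0 : μ T ≠ 0) {p : ℝ} (hp : 1 < p) {φ : E → ℝ} (hφ : ContDiff ℝ 1 φ) :
    μ T * ‖∫ y, fderiv ℝ φ y ∂uniformMeasure μ T‖ₑ ^ p ≤ ∫⁻ x in T, ‖fderiv ℝ φ x‖ₑ ^ p ∂μ := by
  have hUp : IsProbabilityMeasure (uniformMeasure μ T) := isProbabilityMeasure_uniformMeasure hT h0
  have hfd : Continuous fun y => fderiv ℝ φ y := hφ.continuous_fderiv one_ne_zero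
  rw [← smul_uniformMeasure hT h0, lintegral_smul_measure, smul_eq_mul]
  gcongr
  calc _ ≤ (∫⁻ y, ‖fderiv ℝ φ y‖ₑ ∂uniformMeasure μ T) ^ p := by
        gcongr
        exact enorm_integral_le_lintegral_enorm _
    _ ≤ _ := rpow_lintegral_le_lintegral_rpow hp hfd.enorm.measurable.aemeasurable

variable [FiniteDimensional ℝ E]

/-- The interpolant reproduces the means over the facets. -/
theorem integral_facet_sub_crInterpolant_eq_zero (μ : Measure E) [μ.IsAddHaarMeasure] {F : Finset E}
    {P : E} (hP : P ∉ F)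
    (hind : AffineIndependent ℝ ((↑) : (insert P (F : Set E) : Set E) → E)) {m : ℕ}
    (hF : F.card = m + 1) (hmE : Module.finrank ℝ E = m + 1)
    (h0 : μ (convexHull ℝ (insert P (F : Set E))) ≠ 0) {φ : E → ℝ} (hφ : ContDiff ℝ 1 φ) :
    ∫ y in convexHull ℝ (F : Set E),
      (φ y - crInterpolant (m + 1) (uniformMeasure μ (convexHull ℝ (insert P (F : Set E)))) φ y)
        ∂μH[m] = 0 := by
  set T := convexHull ℝ (insert P (F : Set E)) with hT
  have hTc : IsCompact T := (F.finite_toSet.insert P).isCompact_convexHull ℝ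
  set U := uniformMeasure μ T with hU
  have hUp : IsProbabilityMeasure U := isProbabilityMeasure_uniformMeasure hTc h0
  have hint : ∀ {f : E → ℝ}, Continuous f → Integrable f U :=
    fun hf => integrable_uniformMeasure hTc h0 hf
  set A := crInterpolant (m + 1) U φ
  set G := ∫ y, fderiv ℝ φ y ∂U with hG
  set b := barycenter U with hb
  have hAd : ∀ y, HasFDerivAt (fun y => A y) G y := hasFDerivAt_crInterpolant _ _ _
  have hAc : ContDiff ℝ 1 fun y => A y := by
    simp only [A, crInterpolant_apply]
    exact contDiff_const.add (G.contDiff.comp (contDiff_id.sub contDiff_const))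
  obtain ⟨-, c, hc, h⟩ := integral_simplex_eq_facet μ hP hind hF hmE
  have h1 := h (fun y => φ y - A y) (hφ.sub hAc)
  rw [← hT] at h1
  have hfd : Continuous fun y => fderiv ℝ φ y := hφ.continuous_fderiv one_ne_zero
  have hGv : ∀ v, G v = ∫ y, fderiv ℝ φ y v ∂U := fun v =>
    ContinuousLinearMap.integral_apply (integrable_uniformMeasure hTc h0 hfd) v
  have hid : ∫ y, G (y - b) ∂U = 0 := by
    have hi : Integrable (fun y : E => y) U := integrable_uniformMeasure hTc h0 continuous_id
    have hib : Integrable (fun y : E => y - b) U := hi.sub (integrable_const b)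
    rw [G.integral_comp_comm hib, integral_sub hi (integrable_const _)]
    simp [hb, barycenter]
  have key : ∫ y, ((m + 1) * (φ y - A y) + fderiv ℝ (fun y => φ y - A y) y (y - P)) ∂U = 0 := by
    have e : ∀ y, (m + 1) * (φ y - A y) + fderiv ℝ (fun y => φ y - A y) y (y - P) =
        (m + 1) * φ y + fderiv ℝ φ y (y - b) + fderiv ℝ φ y (b - P) -
          ((m + 1) * (∫ y, φ y ∂U + ((m + 1 : ℕ) : ℝ)⁻¹ * ∫ y, fderiv ℝ φ y (y - b) ∂U)
            + G (b - P) + (m + 2) * G (y - b)) := by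
      intro y
      have hfd' : fderiv ℝ (fun y => φ y - A y) y = fderiv ℝ φ y - G :=
        ((hφ.differentiable one_ne_zero y).hasFDerivAt.sub (hAd y)).fderiv
      rw [hfd',
        sub_apply, crInterpolant_apply]
      have e1 : y - P = (y - b) + (b - P) := by abel
      rw [e1, map_add, map_add]
      ring
    have i1 : Integrable (fun y => (m + 1 : ℝ) * φ y) U := hint (continuous_const.mul hφ.continuous)
    have i2 : Integrable (fun y => fderiv ℝ φ y (y - b)) U := hint (hfd.clm_apply (by fun_prop))
    have i3 : Integrable (fun y => fderiv ℝ φ y (b - P)) U := hint (hfd.clm_apply (by fun_prop))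
    have i4 : Integrable (fun y => (m + 2 : ℝ) * G (y - b)) U := hint (by fun_prop)
    have i12 : Integrable (fun y => (m + 1 : ℝ) * φ y + fderiv ℝ φ y (y - b)) U := i1.add i2
    have i123 : Integrable (fun y => (m + 1 : ℝ) * φ y + fderiv ℝ φ y (y - b) +
        fderiv ℝ φ y (b - P)) U := i12.add i3
    have i5 : Integrable (fun y => (m + 1 : ℝ) * (∫ y, φ y ∂U + ((m + 1 : ℕ) : ℝ)⁻¹ *
        ∫ y, fderiv ℝ φ y (y - b) ∂U) + G (b - P) + (m + 2) * G (y - b)) U :=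
      (integrable_const _).add i4
    simp_rw [e]
    rw [integral_sub i123 i5, integral_add i12 i3,
      integral_add i1 i2, integral_add (integrable_const _) i4, integral_const_mul,
      integral_const_mul, hid, ← hGv]
    simp only [integral_const, probReal_univ, one_smul]
    have : (m : ℝ) + 1 ≠ 0 := by positivity
    push_cast
    field_simp
    ring
  have h2 : ∫ y in T, ((m + 1) * (φ y - A y) + fderiv ℝ (fun y => φ y - A y) y (y - P)) ∂μ = 0 := by
    rw [← smul_uniformMeasure hTc h0, integral_smul_measure, key, smul_zero]
  rw [h2] at h1
  exact (mul_eq_zero.1 h1.symm).resolve_left hc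

variable {n : ℕ}

lemma map_sortMap_eq_uniformMeasure (μ : Measure E) [μ.IsAddHaarMeasure]
    (hn : Module.finrank ℝ E = n) {V : Fin (n + 1) → E} (hV : AffineIndependent ℝ V) :
    (cubeMeasure n).map (sortMap V) = uniformMeasure μ (convexHull ℝ (range V)) :=
  map_sortMap_cubeMeasure μ hn hV

lemma measure_simplex_ne_zero (μ : Measure E) [μ.IsAddHaarMeasure]
    (hn : Module.finrank ℝ E = n) {V : Fin (n + 1) → E} (hV : AffineIndependent ℝ V) :
    μ (convexHull ℝ (range V)) ≠ 0 := by
  intro h0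
  have h := map_sortMap_eq_uniformMeasure μ hn hV
  have hp : IsProbabilityMeasure ((cubeMeasure n).map (sortMap V)) :=
    Measure.isProbabilityMeasure_map (continuous_sortMap V).aemeasurable
  have := hp.measure_univ
  rw [h, uniformMeasure, Measure.smul_apply, Measure.restrict_apply_univ, h0] at this
  simp at this

/-- The mean of the uniform distribution on a simplex is the mean of the vertices, because the
distribution does not depend on the order in which the vertices are listed. -/
lemma barycenter_simplex (μ : Measure E) [μ.IsAddHaarMeasure]
    (hn : Module.finrank ℝ E = n) {V : Fin (n + 1) → E} (hV : AffineIndependent ℝ V) :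
    ((n + 1 : ℕ) : ℝ) • barycenter (uniformMeasure μ (convexHull ℝ (range V))) = ∑ i, V i := by
  have hcomp : ∀ j : Fin (n + 1), barycenter (uniformMeasure μ (convexHull ℝ (range V))) =
      ∫ x, sortMap (fun i => V (i + j)) x ∂cubeMeasure n := by
    intro j
    have hV' : AffineIndependent ℝ fun i => V (i + j) :=
      hV.comp_embedding (Equiv.addRight j).toEmbedding
    have hr : range (fun i => V (i + j)) = range V := (Equiv.addRight j).surjective.range_comp V
    rw [← hr, ← map_sortMap_eq_uniformMeasure μ hn hV']
    exact integral_map (f := fun y : E => y) (continuous_sortMap _).aemeasurable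
      aestronglyMeasurable_id
  have hint : ∀ j : Fin (n + 1), Integrable (sortMap fun i => V (i + j)) (cubeMeasure n) := by
    intro j
    rw [cubeMeasure_eq_restrict]
    exact (continuous_sortMap _).continuousOn.integrableOn_compact
      (isCompact_univ_pi fun _ => isCompact_Icc)
  have hsum : ∀ x, ∑ j : Fin (n + 1), sortMap (fun i => V (i + j)) x = ∑ i, V i := by
    intro x
    unfold sortMap
    rw [← integral_finsetSum _ fun j _ => integrable_comp_countAbove (fun i => V (i + j)) x]
    have : ∀ t, ∑ j, V (countAbove x t + j) = ∑ i, V i := fun t =>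
      Equiv.sum_comp (Equiv.addLeft (countAbove x t)) V
    simp [this]
  calc ((n + 1 : ℕ) : ℝ) • barycenter (uniformMeasure μ (convexHull ℝ (range V)))
      = ∑ _j : Fin (n + 1), barycenter (uniformMeasure μ (convexHull ℝ (range V))) := by
        rw [Finset.sum_const, Finset.card_univ, Fintype.card_fin, Nat.cast_smul_eq_nsmul]
    _ = ∑ j : Fin (n + 1), ∫ x, sortMap (fun i => V (i + j)) x ∂cubeMeasure n :=
        Finset.sum_congr rfl fun j _ => hcomp j
    _ = ∑ i, V i := by
        rw [← integral_finsetSum _ fun j _ => hint j]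
        simp [hsum]

lemma norm_sub_barycenter_le (μ : Measure E) [μ.IsAddHaarMeasure]
    (hn : Module.finrank ℝ E = n) {V : Fin (n + 1) → E} (hV : AffineIndependent ℝ V) {h : ℝ}
    (hh : ∀ i j, ‖V i - V j‖ ≤ h) {x : E} (hx : x ∈ convexHull ℝ (range V)) :
    ‖x - barycenter (uniformMeasure μ (convexHull ℝ (range V)))‖ ≤ n / (n + 1) * h := by
  set b := barycenter (uniformMeasure μ (convexHull ℝ (range V))) with hb
  have hn1 : (0 : ℝ) < ((n + 1 : ℕ) : ℝ) := by positivity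
  have hball : convexHull ℝ (range V) ⊆ Metric.closedBall b (n / (n + 1) * h) := by
    refine convexHull_min ?_ (convex_closedBall _ _)
    rintro _ ⟨i, rfl⟩
    rw [Metric.mem_closedBall, dist_eq_norm]
    have e : ((n + 1 : ℕ) : ℝ) • (V i - b) = ∑ j ∈ Finset.univ.erase i, (V i - V j) := by
      rw [Finset.sum_erase _ (by simp), smul_sub, hb, barycenter_simplex μ hn hV,
        Finset.sum_sub_distrib, Finset.sum_const, Finset.card_univ, Fintype.card_fin,
        Nat.cast_smul_eq_nsmul]
    have h1 : ((n + 1 : ℕ) : ℝ) * ‖V i - b‖ ≤ n * h := by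
      calc ((n + 1 : ℕ) : ℝ) * ‖V i - b‖ = ‖((n + 1 : ℕ) : ℝ) • (V i - b)‖ := by
            rw [norm_smul, Real.norm_of_nonneg hn1.le]
        _ ≤ ∑ j ∈ Finset.univ.erase i, ‖V i - V j‖ := by rw [e]; exact norm_sum_le _ _
        _ ≤ ∑ j ∈ Finset.univ.erase i, h := Finset.sum_le_sum fun j _ => hh i j
        _ = n * h := by simp
    push_cast at h1 hn1
    rw [div_mul_eq_mul_div, le_div_iff₀ hn1, mul_comm]
    exact h1
  simpa [dist_eq_norm] using hball hx

/-- The `L^p`-Poincaré inequality on a simplex, with constant `n / 2` times the diameter. -/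
theorem lintegral_sub_mean_simplex_rpow_le (μ : Measure E) [μ.IsAddHaarMeasure]
    (hn : Module.finrank ℝ E = n) {V : Fin (n + 1) → E} (hV : AffineIndependent ℝ V) {h : NNReal}
    (hh : ∀ i j, ‖V i - V j‖ ≤ h) {p : ℝ} (hp : 1 < p) {φ : E → ℝ} (hφ : ContDiff ℝ 1 φ)
    (hc : HasCompactSupport φ) :
    ∫⁻ x, ‖φ x - ∫ y, φ y ∂uniformMeasure μ (convexHull ℝ (range V))‖ₑ ^ p
        ∂uniformMeasure μ (convexHull ℝ (range V)) ≤
      (n / 2 * h) ^ p * ∫⁻ x, ‖fderiv ℝ φ x‖ₑ ^ p ∂uniformMeasure μ (convexHull ℝ (range V)) := by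
  have hm : Measurable (sortMap V) := (continuous_sortMap V).measurable
  have hφm := hφ.continuous.measurable
  have hfm : Measurable fun x => ‖fderiv ℝ φ x‖ₑ := (hφ.continuous_fderiv one_ne_zero).enorm.measurable
  have h1 := lintegral_sub_mean_sortMap_rpow_le hp hφ hc hh
  rw [← map_sortMap_eq_uniformMeasure μ hn hV, lintegral_map (by fun_prop) hm,
    lintegral_map (by fun_prop) hm,
    integral_map hm.aemeasurable hφ.continuous.aestronglyMeasurable]
  refine h1.trans_eq ?_
  simp_rw [ENNReal.mul_rpow_of_nonneg _ _ (by linarith : 0 ≤ p)]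
  have hm' : Measurable fun x => ‖fderiv ℝ φ (sortMap V x)‖ₑ ^ p := (hfm.pow_const p).comp hm
  rw [lintegral_const_mul _ hm', mul_assoc]

/-- Error estimate for the interpolant in `L^p`. Up to the deviation of `φ` from its mean, the error
is at most the diameter times the mean of `‖∇φ‖`: the gradient of the interpolant contributes the
fraction `n / (n + 1)` and the value at the barycenter the fraction `1 / (n + 1)`. -/
theorem lintegral_sub_crInterpolant_rpow_le (μ : Measure E) [μ.IsAddHaarMeasure]
    (hn : Module.finrank ℝ E = n) (hn0 : n ≠ 0) {V : Fin (n + 1) → E} (hV : AffineIndependent ℝ V)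
    {h : NNReal} (hh : ∀ i j, ‖V i - V j‖ ≤ h) {p : ℝ} (hp : 1 < p) {φ : E → ℝ}
    (hφ : ContDiff ℝ 1 φ) (hc : HasCompactSupport φ) :
    ∫⁻ x in convexHull ℝ (range V),
        ‖φ x - crInterpolant n (uniformMeasure μ (convexHull ℝ (range V))) φ x‖ₑ ^ p ∂μ ≤
      ((1 + n / 2) * h) ^ p * ∫⁻ x in convexHull ℝ (range V), ‖fderiv ℝ φ x‖ₑ ^ p ∂μ := by
  have hp0 : 0 < p := by linarith
  set T := convexHull ℝ (range V) with hT
  have hTc : IsCompact T := (finite_range V).isCompact_convexHull ℝ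
  have h0 : μ T ≠ 0 := measure_simplex_ne_zero μ hn hV
  set U := uniformMeasure μ T with hU
  have hUp : IsProbabilityMeasure U := isProbabilityMeasure_uniformMeasure hTc h0
  have hfd : Continuous fun y => fderiv ℝ φ y := hφ.continuous_fderiv one_ne_zero
  set b := barycenter U with hb
  set mean := ∫ y, φ y ∂U with hmean
  set N := ∫⁻ y, ‖fderiv ℝ φ y‖ₑ ∂U with hN
  have hTU : ∀ᵐ x ∂U, x ∈ T :=
    Measure.ae_smul_measure (ae_restrict_mem hTc.isClosed.measurableSet) _
  have hdist : ∀ x ∈ T, ‖x - b‖ₑ ≤ ENNReal.ofReal (n / (n + 1)) * h := by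
    intro x hx
    have := norm_sub_barycenter_le μ hn hV hh hx
    rw [← ofReal_norm, ← ENNReal.ofReal_coe_nnreal (p := h), ← ENNReal.ofReal_mul (by positivity)]
    exact ENNReal.ofReal_le_ofReal this
  have hG : ‖∫ y, fderiv ℝ φ y ∂U‖ₑ ≤ N := enorm_integral_le_lintegral_enorm _
  have hpoint : ∀ᵐ x ∂U, ‖φ x - crInterpolant n U φ x‖ₑ ≤ ‖φ x - mean‖ₑ + h * N := by
    filter_upwards [hTU] with x hx
    have e : φ x - crInterpolant n U φ x = (φ x - mean) + (-((n : ℝ)⁻¹ *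
        ∫ y, fderiv ℝ φ y (y - b) ∂U) + -((∫ y, fderiv ℝ φ y ∂U) (x - b))) := by
      rw [crInterpolant_apply]; ring
    have e1 : ‖(n : ℝ)⁻¹ * ∫ y, fderiv ℝ φ y (y - b) ∂U‖ₑ ≤ ENNReal.ofReal (1 / (n + 1)) * h * N := by
      rw [enorm_mul]
      have : ‖∫ y, fderiv ℝ φ y (y - b) ∂U‖ₑ ≤ ENNReal.ofReal (n / (n + 1)) * h * N := by
        refine (enorm_integral_le_lintegral_enorm _).trans ?_
        rw [hN, ← lintegral_const_mul _ hfd.enorm.measurable]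
        apply lintegral_mono_ae
        filter_upwards [hTU] with y hy
        refine ((fderiv ℝ φ y).le_opENorm _).trans ?_
        rw [mul_comm]
        gcongr
        exact hdist y hy
      calc _ ≤ ‖(n : ℝ)⁻¹‖ₑ * (ENNReal.ofReal (n / (n + 1)) * h * N) := by gcongr
        _ = _ := by
          rw [Real.enorm_of_nonneg (by positivity), ← mul_assoc, ← mul_assoc,
            ← ENNReal.ofReal_mul (by positivity)]
          congr 3
          field_simp
    have e2 : ‖(∫ y, fderiv ℝ φ y ∂U) (x - b)‖ₑ ≤ ENNReal.ofReal (n / (n + 1)) * h * N := by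
      refine ((∫ y, fderiv ℝ φ y ∂U).le_opENorm _).trans ?_
      rw [mul_comm]
      gcongr
      exact hdist x hx
    rw [e]
    refine (enorm_add_le _ _).trans (add_le_add le_rfl ((enorm_add_le _ _).trans ?_))
    rw [enorm_neg, enorm_neg]
    refine (add_le_add e1 e2).trans_eq ?_
    rw [← add_mul, ← add_mul, ← ENNReal.ofReal_add (by positivity) (by positivity)]
    have : (1 / (n + 1) + n / (n + 1) : ℝ) = 1 := by field_simp; ring
    rw [this, ENNReal.ofReal_one, one_mul]
  set J := ∫⁻ x, ‖fderiv ℝ φ x‖ₑ ^ p ∂U with hJ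
  have hNJ : N ≤ J ^ (1 / p) := by
    have := rpow_lintegral_le_lintegral_rpow (μ := U) hp hfd.enorm.measurable.aemeasurable
    calc N = (N ^ p) ^ (1 / p) := by
          rw [← ENNReal.rpow_mul, mul_one_div_cancel hp0.ne', ENNReal.rpow_one]
      _ ≤ _ := ENNReal.rpow_le_rpow this (by positivity)
  have hpoinc := lintegral_sub_mean_simplex_rpow_le μ hn hV hh hp hφ hc
  rw [← hT, ← hU, ← hmean, ← hJ] at hpoinc
  have hroot : (∫⁻ x, ‖φ x - crInterpolant n U φ x‖ₑ ^ p ∂U) ^ (1 / p) ≤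
      (1 + n / 2) * h * J ^ (1 / p) := by
    calc _ ≤ (∫⁻ x, (‖φ x - mean‖ₑ + h * N) ^ p ∂U) ^ (1 / p) := by
          refine ENNReal.rpow_le_rpow (lintegral_mono_ae ?_) (by positivity)
          filter_upwards [hpoint] with x hx
          exact ENNReal.rpow_le_rpow hx hp0.le
      _ ≤ (∫⁻ x, ‖φ x - mean‖ₑ ^ p ∂U) ^ (1 / p) + (∫⁻ _, (h * N) ^ p ∂U) ^ (1 / p) :=
          ENNReal.lintegral_Lp_add_le (hφ.continuous.measurable.sub_const _).enorm.aemeasurable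
            aemeasurable_const hp.le
      _ ≤ ((n / 2 * h) ^ p * J) ^ (1 / p) + h * N := by
          gcongr
          rw [lintegral_const, measure_univ, mul_one, ← ENNReal.rpow_mul,
            mul_one_div_cancel hp0.ne', ENNReal.rpow_one]
      _ ≤ n / 2 * h * J ^ (1 / p) + h * J ^ (1 / p) := by
          rw [ENNReal.mul_rpow_of_nonneg _ _ (by positivity), ← ENNReal.rpow_mul,
            mul_one_div_cancel hp0.ne', ENNReal.rpow_one]
          gcongr
      _ = _ := by ring
  have hfinal : ∫⁻ x, ‖φ x - crInterpolant n U φ x‖ₑ ^ p ∂U ≤ ((1 + n / 2) * h) ^ p * J := by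
    calc _ = ((∫⁻ x, ‖φ x - crInterpolant n U φ x‖ₑ ^ p ∂U) ^ (1 / p)) ^ p := by
          rw [← ENNReal.rpow_mul, one_div_mul_cancel hp0.ne', ENNReal.rpow_one]
      _ ≤ ((1 + n / 2) * h * J ^ (1 / p)) ^ p := ENNReal.rpow_le_rpow hroot hp0.le
      _ = _ := by
          rw [ENNReal.mul_rpow_of_nonneg _ _ hp0.le, ← ENNReal.rpow_mul,
            one_div_mul_cancel hp0.ne', ENNReal.rpow_one]
  rw [← smul_uniformMeasure hTc h0, lintegral_smul_measure, lintegral_smul_measure, smul_eq_mul,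
    smul_eq_mul, mul_left_comm]
  gcongr

end Interpolant

/-! ### The interpolant on a triangulation -/

section Mesh

section NullSets

variable {E : Type*} [NormedAddCommGroup E] [NormedSpace ℝ E] [FiniteDimensional ℝ E]
  [MeasurableSpace E] [BorelSpace E]

lemma measure_convexHull_eq_zero (μ : Measure E) [μ.IsAddHaarMeasure] {s : Finset E}
    (hs : AffineIndependent ℝ ((↑) : s → E)) (hcard : s.card ≠ Module.finrank ℝ E + 1) :
    μ (convexHull ℝ (s : Set E)) = 0 := by
  refine measure_mono_null (convexHull_subset_affineSpan _) (Measure.addHaar_affineSubspace μ _ ?_)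
  intro h
  apply hcard
  have h' : affineSpan ℝ (range ((↑) : s → E)) = ⊤ := by
    rw [← h]; congr 1; exact Subtype.range_coe
  simpa using hs.affineSpan_eq_top_iff_card_eq_finrank_add_one.1 h'

end NullSets

variable {d : ℕ} {Ω : Set (EuclideanSpace ℝ (Fin d))}

namespace Triangulation

variable (𝒯 : Triangulation Ω)

/-- The closed simplex spanned by the vertices of a cell. -/
def hull (T : 𝒯.cells) : Set (EuclideanSpace ℝ (Fin d)) :=
  convexHull ℝ (T.1 : Set (EuclideanSpace ℝ (Fin d)))

lemma mem_faces (T : 𝒯.cells) : T.1 ∈ 𝒯.faces := by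
  exact 𝒯.finite_faces.mem_toFinset.1 (Finset.mem_filter.1 T.2).1

lemma card_cell (T : 𝒯.cells) : T.1.card = d + 1 := by
  exact (Finset.mem_filter.1 T.2).2

lemma isCompact_hull (T : 𝒯.cells) : IsCompact (𝒯.hull T) :=
  T.1.finite_toSet.isCompact_convexHull ℝ

lemma measurableSet_hull (T : 𝒯.cells) : MeasurableSet (𝒯.hull T) :=
  (𝒯.isCompact_hull T).isClosed.measurableSet

/-- The vertices of a cell as an affinely independent family. -/
lemma exists_vertices (T : 𝒯.cells) : ∃ V : Fin (d + 1) → EuclideanSpace ℝ (Fin d),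
    AffineIndependent ℝ V ∧ range V = (T.1 : Set (EuclideanSpace ℝ (Fin d))) := by
  let e : T.1 ≃ Fin (d + 1) := T.1.equivFinOfCardEq (𝒯.card_cell T)
  refine ⟨fun i => (e.symm i : EuclideanSpace ℝ (Fin d)),
    (𝒯.indep (𝒯.mem_faces T)).comp_embedding e.symm.toEmbedding, ?_⟩
  have := e.symm.surjective.range_comp ((↑) : T.1 → EuclideanSpace ℝ (Fin d))
  rw [Subtype.range_coe] at this
  exact this

lemma volume_hull_ne_zero (T : 𝒯.cells) : volume (𝒯.hull T) ≠ 0 := by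
  obtain ⟨V, hV, hr⟩ := 𝒯.exists_vertices T
  rw [hull, ← hr]
  exact measure_simplex_ne_zero volume finrank_euclideanSpace_fin hV

lemma diam_hull_le (T : 𝒯.cells) : Metric.diam (𝒯.hull T) ≤ 𝒯.maxDiam :=
  le_ciSup (f := fun T : 𝒯.cells =>
    Metric.diam (convexHull ℝ (T.1 : Set (EuclideanSpace ℝ (Fin d))))) (finite_range _).bddAbove T

lemma maxDiam_nonneg : 0 ≤ 𝒯.maxDiam := Real.iSup_nonneg fun _ => Metric.diam_nonneg

lemma aedisjoint_hull : Pairwise fun T T' : 𝒯.cells =>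
    AEDisjoint volume (𝒯.hull T) (𝒯.hull T') := by
  classical
  intro T T' hne
  have hinter : 𝒯.hull T ∩ 𝒯.hull T' =
      convexHull ℝ ((T.1 ∩ T'.1 : Finset _) : Set (EuclideanSpace ℝ (Fin d))) := by
    rw [Finset.coe_inter]
    exact Geometry.SimplicialComplex.convexHull_inter_convexHull (𝒯.mem_faces T) (𝒯.mem_faces T')
  rw [AEDisjoint, hinter]
  refine measure_convexHull_eq_zero volume ?_ ?_
  · exact (𝒯.indep (𝒯.mem_faces T)).mono
      (s := ((T.1 ∩ T'.1 : Finset _) : Set (EuclideanSpace ℝ (Fin d))))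
      (by simp)
  · rw [finrank_euclideanSpace_fin]
    intro h
    apply hne
    have h1 : T.1 ∩ T'.1 = T.1 :=
      Finset.eq_of_subset_of_card_le Finset.inter_subset_left (by rw [h, 𝒯.card_cell])
    have h2 : T.1 ∩ T'.1 = T'.1 :=
      Finset.eq_of_subset_of_card_le Finset.inter_subset_right (by rw [h, 𝒯.card_cell])
    exact Subtype.ext (h1.symm.trans h2)

lemma ae_mem_iUnion_hull : ∀ᵐ x, x ∈ Ω → x ∈ ⋃ T, 𝒯.hull T := by
  have hnull : ∀ᵐ x : EuclideanSpace ℝ (Fin d), ∀ s ∈ 𝒯.faces, s.card ≠ d + 1 →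
      x ∉ convexHull ℝ (s : Set (EuclideanSpace ℝ (Fin d))) := by
    rw [ae_ball_iff 𝒯.finite_faces.countable]
    intro s hs
    by_cases hc : s.card = d + 1
    · exact .of_forall fun x h => absurd hc h
    · have := measure_convexHull_eq_zero volume (𝒯.indep hs) (by simpa using hc)
      filter_upwards [measure_eq_zero_iff_ae_notMem.1 this] with x hx _ using hx
  filter_upwards [hnull] with x hx hxΩ
  have hx' : x ∈ 𝒯.space := by rw [𝒯.space_eq]; exact subset_closure hxΩ
  obtain ⟨s, hs, hxs⟩ := Geometry.SimplicialComplex.mem_space_iff.1 hx'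
  have hc : s.card = d + 1 := by
    by_contra hc
    exact hx s hs hc hxs
  exact mem_iUnion.2 ⟨⟨s, by simp [cells, hs, hc]⟩, hxs⟩

lemma measurable_toFun (v : 𝒯.PiecewiseAffine) : Measurable (𝒯.toFun v) := by
  unfold toFun
  exact Finset.measurable_sum _ fun T _ =>
    (v T).continuous_of_finiteDimensional.measurable.indicator isOpen_interior.measurableSet

lemma toFun_ae_eq (v : 𝒯.PiecewiseAffine) (T : 𝒯.cells) :
    ∀ᵐ x ∂volume.restrict (𝒯.hull T), 𝒯.toFun v x = v T x := by
  rw [ae_restrict_iff' (𝒯.measurableSet_hull T)]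
  have h1 : ∀ᵐ x : EuclideanSpace ℝ (Fin d), x ∉ frontier (𝒯.hull T) :=
    measure_eq_zero_iff_ae_notMem.1 ((convex_convexHull ℝ _).addHaar_frontier volume)
  have h2 : ∀ᵐ x : EuclideanSpace ℝ (Fin d), ∀ T', T ≠ T' → x ∉ 𝒯.hull T ∩ 𝒯.hull T' := by
    rw [ae_all_iff]
    intro T'
    by_cases hne : T = T'
    · exact .of_forall fun x h => absurd hne h
    · filter_upwards [measure_eq_zero_iff_ae_notMem.1 (𝒯.aedisjoint_hull hne)] with x hx _ using hx
  filter_upwards [h1, h2] with x hx1 hx2 hxT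
  unfold toFun
  rw [Finset.sum_eq_single T]
  · refine indicator_of_mem ?_ _
    by_contra hni
    exact hx1 ⟨subset_closure hxT, hni⟩
  · intro T' _ hne
    exact indicator_of_notMem (fun h => hx2 T' hne.symm ⟨hxT, interior_subset h⟩) _
  · simp

/-- The Crouzeix–Raviart interpolant of a function. -/
def interpolate (φ : EuclideanSpace ℝ (Fin d) → ℝ) : 𝒯.PiecewiseAffine :=
  fun T => crInterpolant d (uniformMeasure volume (𝒯.hull T)) φ

variable {φ : EuclideanSpace ℝ (Fin d) → ℝ}

/-- A facet of a cell has finite surface measure, and the interpolant has the right mean on it. -/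
lemma integral_facet_sub_interpolate (hd : d ≠ 0) (hφ : ContDiff ℝ 1 φ) (T : 𝒯.cells)
    {F : Finset (EuclideanSpace ℝ (Fin d))} (hF : F.card = d) (hFT : F ⊆ T.1) :
    μH[(d : ℝ) - 1] (convexHull ℝ (F : Set (EuclideanSpace ℝ (Fin d)))) < ⊤ ∧
    ∫ x in convexHull ℝ (F : Set (EuclideanSpace ℝ (Fin d))), (φ x - 𝒯.interpolate φ T x)
      ∂μH[(d : ℝ) - 1] = 0 := by
  classical
  obtain ⟨m, rfl⟩ := Nat.exists_eq_succ_of_ne_zero hd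
  obtain ⟨P, hP, hPT⟩ := Finset.exists_eq_insert_iff.2 ⟨hFT, by rw [hF, 𝒯.card_cell]⟩
  have hPT' : insert P (F : Set (EuclideanSpace ℝ (Fin (m + 1)))) = T.1 := by
    rw [← hPT, Finset.coe_insert]
  have hind : AffineIndependent ℝ
      ((↑) : ↥(insert P (F : Set (EuclideanSpace ℝ (Fin (m + 1))))) →
        EuclideanSpace ℝ (Fin (m + 1))) := by
    rw [hPT']
    exact 𝒯.indep (𝒯.mem_faces T)
  have hfin : Module.finrank ℝ (EuclideanSpace ℝ (Fin (m + 1))) = m + 1 := finrank_euclideanSpace_fin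
  have h0 : volume (convexHull ℝ (insert P (F : Set (EuclideanSpace ℝ (Fin (m + 1)))))) ≠ 0 := by
    rw [hPT']; exact 𝒯.volume_hull_ne_zero T
  have e : (((m.succ : ℕ) : ℝ) - 1) = m := by push_cast; ring
  rw [e]
  refine ⟨(integral_simplex_eq_facet volume hP hind hF hfin).1, ?_⟩
  have := integral_facet_sub_crInterpolant_eq_zero volume hP hind hF hfin h0 hφ
  rw [hPT'] at this
  exact this

/-- The interpolant of a function that vanishes outside `Ω` is a Crouzeix–Raviart function. -/
theorem interpolate_mem_crouzeixRaviart (hd : d ≠ 0) (hΩ : IsOpen Ω) (hφ : ContDiff ℝ 1 φ)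
    (hsupp : ∀ x ∉ Ω, φ x = 0) : 𝒯.interpolate φ ∈ 𝒯.crouzeixRaviart := by
  rintro F ⟨hF, -⟩
  have hFc : IsCompact (convexHull ℝ (F : Set (EuclideanSpace ℝ (Fin d)))) :=
    F.finite_toSet.isCompact_convexHull ℝ
  refine ⟨fun hfr T hFT => ?_, fun _ T₁ T₂ h₁ h₂ => ?_⟩
  · have h := (𝒯.integral_facet_sub_interpolate hd hφ T hF hFT).2
    rw [← neg_eq_zero, ← integral_neg, ← h]
    refine setIntegral_congr_fun hFc.isClosed.measurableSet fun x hx => ?_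
    have : x ∉ Ω := fun hxΩ => by
      have := hfr hx
      rw [hΩ.frontier_eq] at this
      exact this.2 hxΩ
    simp [hsupp x this]
  · obtain ⟨hfin, e₁⟩ := 𝒯.integral_facet_sub_interpolate hd hφ T₁ hF h₁
    obtain ⟨-, e₂⟩ := 𝒯.integral_facet_sub_interpolate hd hφ T₂ hF h₂
    have hint : ∀ T, IntegrableOn (fun x => φ x - 𝒯.interpolate φ T x)
        (convexHull ℝ (F : Set (EuclideanSpace ℝ (Fin d)))) μH[(d : ℝ) - 1] := fun T => by
      have hc : ContinuousOn (fun x => φ x - 𝒯.interpolate φ T x)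
          (convexHull ℝ (F : Set (EuclideanSpace ℝ (Fin d)))) :=
        (hφ.continuous.sub (𝒯.interpolate φ T).continuous_of_finiteDimensional).continuousOn
      obtain ⟨C, hC⟩ := hFc.exists_bound_of_continuousOn hc
      exact IntegrableOn.of_bound hfin (hc.aestronglyMeasurable hFc.isClosed.measurableSet) C
        ((ae_restrict_iff' hFc.isClosed.measurableSet).2 (.of_forall hC))
    have e : ∀ x, 𝒯.interpolate φ T₁ x - 𝒯.interpolate φ T₂ x =
        (φ x - 𝒯.interpolate φ T₂ x) - (φ x - 𝒯.interpolate φ T₁ x) := fun x => by ring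
    simp_rw [e]
    rw [integral_sub (hint T₂) (hint T₁), e₁, e₂, sub_zero]

/-- The cells do not overlap, so that integrals over them add up to at most an integral over `Ω`. -/
lemma sum_lintegral_hull_le (f : EuclideanSpace ℝ (Fin d) → ℝ≥0∞) (hΩ : MeasurableSet Ω)
    (hf : ∀ x ∉ Ω, f x = 0) :
    ∑ T, ∫⁻ x in 𝒯.hull T, f x ≤ ∫⁻ x in Ω, f x := by
  rw [← tsum_fintype (L := .unconditional _), ← lintegral_iUnion₀
    (fun T => (𝒯.measurableSet_hull T).nullMeasurableSet) 𝒯.aedisjoint_hull]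
  refine (setLIntegral_le_lintegral _ _).trans_eq ?_
  rw [← lintegral_indicator hΩ]
  congr with x
  by_cases hx : x ∈ Ω <;> simp [hx, hf]

/-- The interpolation error. -/
theorem lintegral_sub_interpolate_rpow_le (hd : d ≠ 0) (hΩ : MeasurableSet Ω) {p : ℝ} (hp : 1 < p)
    (hφ : ContDiff ℝ 1 φ) (hc : HasCompactSupport φ) (hsupp : ∀ x ∉ Ω, fderiv ℝ φ x = 0) :
    ∫⁻ x in Ω, ‖φ x - 𝒯.toFun (𝒯.interpolate φ) x‖ₑ ^ p ≤
      ENNReal.ofReal ((1 + d / 2) * 𝒯.maxDiam) ^ p * ∫⁻ x in Ω, ‖fderiv ℝ φ x‖ₑ ^ p := by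
  have hp0 : 0 < p := by linarith
  have hcell : ∀ T, ∫⁻ x in 𝒯.hull T, ‖φ x - 𝒯.toFun (𝒯.interpolate φ) x‖ₑ ^ p ≤
      ENNReal.ofReal ((1 + d / 2) * 𝒯.maxDiam) ^ p * ∫⁻ x in 𝒯.hull T, ‖fderiv ℝ φ x‖ₑ ^ p := by
    intro T
    obtain ⟨V, hV, hr⟩ := 𝒯.exists_vertices T
    obtain ⟨D, hD⟩ : ∃ D : NNReal, (D : ℝ) = 𝒯.maxDiam := ⟨⟨_, 𝒯.maxDiam_nonneg⟩, rfl⟩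
    have hh : ∀ i j, ‖V i - V j‖ ≤ D := by
      intro i j
      rw [← dist_eq_norm, hD]
      have hmem : ∀ i, V i ∈ 𝒯.hull T := fun i => by
        rw [hull, ← hr]; exact subset_convexHull ℝ _ (mem_range_self i)
      exact (Metric.dist_le_diam_of_mem (𝒯.isCompact_hull T).isBounded (hmem i) (hmem j)).trans
        (𝒯.diam_hull_le T)
    have h := lintegral_sub_crInterpolant_rpow_le volume finrank_euclideanSpace_fin hd hV hh hp hφ hc
    rw [hr] at h
    have hconst : (1 + d / 2 : ℝ≥0∞) * D =
        ENNReal.ofReal ((1 + d / 2) * 𝒯.maxDiam) := by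
      rw [← hD, ENNReal.ofReal_mul (by positivity), ENNReal.ofReal_add zero_le_one (by positivity),
        ENNReal.ofReal_div_of_pos (by norm_num), ENNReal.ofReal_one, ENNReal.ofReal_natCast,
        ENNReal.ofReal_ofNat, ENNReal.ofReal_coe_nnreal]
    rw [hconst] at h
    refine le_trans (lintegral_congr_ae ?_).le h
    filter_upwards [𝒯.toFun_ae_eq (𝒯.interpolate φ) T] with x hx
    rw [hx]
    rfl
  calc ∫⁻ x in Ω, ‖φ x - 𝒯.toFun (𝒯.interpolate φ) x‖ₑ ^ p
      ≤ ∫⁻ x in ⋃ T, 𝒯.hull T, ‖φ x - 𝒯.toFun (𝒯.interpolate φ) x‖ₑ ^ p :=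
        lintegral_mono_set' 𝒯.ae_mem_iUnion_hull
    _ ≤ ∑ T, ∫⁻ x in 𝒯.hull T, ‖φ x - 𝒯.toFun (𝒯.interpolate φ) x‖ₑ ^ p := by
        refine (lintegral_iUnion_le _ _).trans_eq ?_
        rw [tsum_fintype]
    _ ≤ ∑ T, ENNReal.ofReal ((1 + d / 2) * 𝒯.maxDiam) ^ p *
          ∫⁻ x in 𝒯.hull T, ‖fderiv ℝ φ x‖ₑ ^ p := Finset.sum_le_sum fun T _ => hcell T
    _ ≤ _ := by
        rw [← Finset.mul_sum]
        gcongr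
        exact 𝒯.sum_lintegral_hull_le _ hΩ fun x hx => by
          rw [hsupp x hx, ← ofReal_norm, norm_zero, ENNReal.ofReal_zero, ENNReal.zero_rpow_of_pos hp0]

/-- The interpolant has no larger energy than the function. -/
theorem energy_interpolate_le (hΩ : MeasurableSet Ω) {p : ℝ} (hp : 1 < p)
    (hφ : ContDiff ℝ 1 φ) (hsupp : ∀ x ∉ Ω, fderiv ℝ φ x = 0) :
    ENNReal.ofReal (∑ T : 𝒯.cells, ∫ x in convexHull ℝ (T.1 : Set (EuclideanSpace ℝ (Fin d))),
      ‖gradient (fun y => 𝒯.interpolate φ T y) x‖ ^ p) ≤ ∫⁻ x in Ω, ‖fderiv ℝ φ x‖ₑ ^ p := by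
  have hp0 : 0 < p := by linarith
  refine le_trans ?_ (𝒯.sum_lintegral_hull_le (fun x => ‖fderiv ℝ φ x‖ₑ ^ p) hΩ
    fun x hx => by
          rw [hsupp x hx, ← ofReal_norm, norm_zero, ENNReal.ofReal_zero, ENNReal.zero_rpow_of_pos hp0])
  rw [ENNReal.ofReal_sum_of_nonneg fun T _ => integral_nonneg fun x => by positivity]
  refine Finset.sum_le_sum fun T _ => ?_
  refine le_trans (le_of_eq ?_) (mul_enorm_integral_fderiv_rpow_le volume (𝒯.isCompact_hull T)
    (𝒯.volume_hull_ne_zero T) hp hφ)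
  have hgrad : ∀ x, ‖gradient (fun y => 𝒯.interpolate φ T y) x‖ =
      ‖∫ y, fderiv ℝ φ y ∂uniformMeasure volume (𝒯.hull T)‖ := by
    intro x
    rw [← (hasFDerivAt_crInterpolant d (uniformMeasure volume (𝒯.hull T)) φ x).fderiv, gradient,
      LinearIsometryEquiv.norm_map]
    rfl
  simp_rw [hgrad]
  rw [setIntegral_const, smul_eq_mul, ENNReal.ofReal_mul measureReal_nonneg]
  change ENNReal.ofReal (volume (𝒯.hull T)).toReal * _ = _
  rw [ENNReal.ofReal_toReal (𝒯.isCompact_hull T).measure_lt_top.ne,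
    ← ENNReal.ofReal_rpow_of_nonneg (norm_nonneg _) hp0.le, ofReal_norm]

end Triangulation

end Mesh

/-! ### Test functions and the discrete eigenvalue -/

section Eigenvalue

variable {d : ℕ} {Ω : Set (EuclideanSpace ℝ (Fin d))}

lemma eLpNorm_ofReal_eq {X F : Type*} [MeasurableSpace X] [NormedAddCommGroup F] {μ : Measure X}
    {p : ℝ} (hp : 0 < p) (f : X → F) :
    eLpNorm f (ENNReal.ofReal p) μ = (∫⁻ x, ‖f x‖ₑ ^ p ∂μ) ^ (1 / p) := by
  rw [eLpNorm_eq_lintegral_rpow_enorm_toReal (by simpa using hp) ENNReal.ofReal_ne_top,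
    ENNReal.toReal_ofReal hp.le]

lemma enorm_gradient (φ : EuclideanSpace ℝ (Fin d) → ℝ) (x : EuclideanSpace ℝ (Fin d)) :
    ‖gradient φ x‖ₑ = ‖fderiv ℝ φ x‖ₑ := by
  rw [← ofReal_norm, ← ofReal_norm, gradient, LinearIsometryEquiv.norm_map]

namespace IsTestFunction

variable {φ : EuclideanSpace ℝ (Fin d) → ℝ}

lemma contDiff_one (h : IsTestFunction Ω φ) : ContDiff ℝ 1 φ := h.1.of_le (by exact_mod_cast le_top)

lemma eq_zero (h : IsTestFunction Ω φ) {x : EuclideanSpace ℝ (Fin d)} (hx : x ∉ Ω) : φ x = 0 :=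
  image_eq_zero_of_notMem_tsupport fun hx' => hx (h.2.2 hx')

lemma fderiv_eq_zero (h : IsTestFunction Ω φ) {x : EuclideanSpace ℝ (Fin d)} (hx : x ∉ Ω) :
    fderiv ℝ φ x = 0 :=
  fderiv_of_notMem_tsupport ℝ fun hx' => hx (h.2.2 hx')

lemma continuous_gradient (h : IsTestFunction Ω φ) : Continuous (gradient φ) :=
  (InnerProductSpace.toDual ℝ (EuclideanSpace ℝ (Fin d))).symm.continuous.comp
    (h.contDiff_one.continuous_fderiv one_ne_zero)

lemma hasCompactSupport_gradient (h : IsTestFunction Ω φ) : HasCompactSupport (gradient φ) :=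
  (h.2.1.fderiv ℝ).comp_left
    (g := (InnerProductSpace.toDual ℝ (EuclideanSpace ℝ (Fin d))).symm) (map_zero _)

lemma memLp (h : IsTestFunction Ω φ) (p : ℝ≥0∞) (μ : Measure (EuclideanSpace ℝ (Fin d)))
    [IsFiniteMeasureOnCompacts μ] : MemLp φ p μ :=
  h.1.continuous.memLp_of_hasCompactSupport h.2.1

lemma memLp_gradient (h : IsTestFunction Ω φ) (p : ℝ≥0∞)
    (μ : Measure (EuclideanSpace ℝ (Fin d))) [IsFiniteMeasureOnCompacts μ] :
    MemLp (gradient φ) p μ :=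
  h.continuous_gradient.memLp_of_hasCompactSupport h.hasCompactSupport_gradient

lemma hasWeakGradient (h : IsTestFunction Ω φ) : HasWeakGradient Ω φ (gradient φ) := by
  intro ψ hψ
  have i₁ : Integrable fun x => φ x • gradient ψ x :=
    (h.1.continuous.smul hψ.continuous_gradient).integrable_of_hasCompactSupport h.2.1.smul_right
  have i₂ : Integrable fun x => ψ x • gradient φ x :=
    (hψ.1.continuous.smul h.continuous_gradient).integrable_of_hasCompactSupport hψ.2.1.smul_right
  have i₃ : Integrable fun x => φ x * ψ x :=
    (h.1.continuous.mul hψ.1.continuous).integrable_of_hasCompactSupport h.2.1.mul_right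
  rw [setIntegral_eq_integral_of_forall_compl_eq_zero fun x hx => by rw [h.eq_zero hx, zero_smul],
    setIntegral_eq_integral_of_forall_compl_eq_zero fun x hx => by rw [hψ.eq_zero hx, zero_smul]]
  refine ext_inner_left ℝ fun v => ?_
  have hinner : ∀ (f : EuclideanSpace ℝ (Fin d) → ℝ) (x : EuclideanSpace ℝ (Fin d)),
      inner ℝ v (gradient f x) = fderiv ℝ f x v := fun f x => by
    rw [real_inner_comm, gradient, InnerProductSpace.toDual_symm_apply]
  have e₁ : ∀ x, inner ℝ v (φ x • gradient ψ x) = φ x * fderiv ℝ ψ x v := fun x => by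
    rw [real_inner_smul_right, hinner]
  have e₂ : ∀ x, inner ℝ v (ψ x • gradient φ x) = fderiv ℝ φ x v * ψ x := fun x => by
    rw [real_inner_smul_right, hinner, mul_comm]
  have j₁ := i₁.const_inner (𝕜 := ℝ) v
  have j₂ := i₂.const_inner (𝕜 := ℝ) v
  rw [inner_neg_right, ← integral_inner i₁, ← integral_inner i₂]
  simp only [e₁, e₂] at j₁ j₂ ⊢
  exact integral_mul_fderiv_eq_neg_fderiv_mul_of_integrable j₂ j₁ i₃
    (fun x _ => h.contDiff_one.differentiable one_ne_zero x)
    (fun x _ => hψ.contDiff_one.differentiable one_ne_zero x)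

lemma memW0 (h : IsTestFunction Ω φ) (p : ℝ) : MemW0 p Ω φ (gradient φ) where
  memLp := h.memLp _ _
  memLp_grad := h.memLp_gradient _ _
  weakGradient := h.hasWeakGradient
  approx := ⟨fun _ => φ, fun _ => h, by simp, by simp⟩

end IsTestFunction

lemma exists_isTestFunction_ne_zero (hΩ : IsOpen Ω) (hne : Ω.Nonempty) :
    ∃ φ, IsTestFunction Ω φ ∧ ¬ (φ =ᵐ[volume.restrict Ω] 0) := by
  obtain ⟨c, hc⟩ := hne
  obtain ⟨r, hr, hball⟩ := Metric.nhds_basis_closedBall.mem_iff.1 (hΩ.mem_nhds hc)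
  let f : ContDiffBump c := ⟨r / 2, r, by positivity, by linarith⟩
  refine ⟨f, ⟨f.contDiff, f.hasCompactSupport, ?_⟩, fun h => ?_⟩
  · rw [f.tsupport_eq]; exact hball
  · have hcont := Measure.eqOn_open_of_ae_eq h hΩ f.continuous.continuousOn continuousOn_const
    have h1 := hcont hc
    have h2 : f c = 1 := f.one_of_mem_closedBall (Metric.mem_closedBall_self (by positivity))
    simp [h2] at h1

namespace Triangulation

variable {𝒯 : Triangulation Ω} {p μ : ℝ} {u : 𝒯.PiecewiseAffine}

lemma rayleigh_nonneg (v : 𝒯.PiecewiseAffine) : 0 ≤ 𝒯.rayleigh p v :=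
  div_nonneg (Finset.sum_nonneg fun T _ => integral_nonneg fun x => by positivity)
    (integral_nonneg fun x => by positivity)

lemma IsDiscreteSolution.nonneg (h : 𝒯.IsDiscreteSolution p μ u) : 0 ≤ μ := by
  rw [← h.rayleigh_eq]; exact rayleigh_nonneg u

/-- The minimality of the discrete eigenvalue without a division: it holds also for the zero
function. -/
lemma IsDiscreteSolution.mul_integral_le (h : 𝒯.IsDiscreteSolution p μ u) (hp : 0 < p)
    {v : 𝒯.PiecewiseAffine} (hv : v ∈ 𝒯.crouzeixRaviart) :
    μ * ∫ x in Ω, |𝒯.toFun v x| ^ p ≤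
      ∑ T : 𝒯.cells, ∫ x in convexHull ℝ (T.1 : Set (EuclideanSpace ℝ (Fin d))),
        ‖gradient (fun y => v T y) x‖ ^ p := by
  have hS : 0 ≤ ∑ T : 𝒯.cells, ∫ x in convexHull ℝ (T.1 : Set (EuclideanSpace ℝ (Fin d))),
        ‖gradient (fun y => v T y) x‖ ^ p :=
    Finset.sum_nonneg fun T _ => integral_nonneg fun x => by positivity
  rcases (integral_nonneg fun x => by positivity :
    0 ≤ ∫ x in Ω, |𝒯.toFun v x| ^ p).eq_or_lt with hD | hD
  · rwa [← hD, mul_zero]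
  · refine (le_div_iff₀ hD).1 (h.isMin v hv ?_)
    rintro rfl
    simp [toFun, Real.zero_rpow hp.ne'] at hD

/-- The lower bound for test functions: compare the discrete eigenvalue with the Rayleigh quotient of
the interpolant, whose energy is at most that of `φ` and whose norm differs from that of `φ` by at
most the interpolation error. -/
theorem IsDiscreteSolution.eLpNorm_le (h : 𝒯.IsDiscreteSolution p μ u) (hp : 1 < p) (hd : d ≠ 0)
    (hΩ : IsOpen Ω) {φ : EuclideanSpace ℝ (Fin d) → ℝ} (hφ : IsTestFunction Ω φ) :
    ENNReal.ofReal (μ ^ (1 / p)) * eLpNorm φ (ENNReal.ofReal p) (volume.restrict Ω) ≤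
      ENNReal.ofReal (1 + (1 + d / 2) * 𝒯.maxDiam * μ ^ (1 / p)) *
        eLpNorm (gradient φ) (ENNReal.ofReal p) (volume.restrict Ω) := by
  have hp0 : 0 < p := by linarith
  have hμ := h.nonneg
  set P := ENNReal.ofReal p with hP
  have hP1 : 1 ≤ P := by rw [hP]; simpa using hp.le
  set κ := ENNReal.ofReal ((1 + d / 2) * 𝒯.maxDiam) with hκ
  set m := ENNReal.ofReal (μ ^ (1 / p)) with hm
  set w := 𝒯.interpolate φ with hw
  have hB : eLpNorm (gradient φ) P (volume.restrict Ω) =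
      (∫⁻ x in Ω, ‖fderiv ℝ φ x‖ₑ ^ p) ^ (1 / p) := by
    rw [hP, eLpNorm_ofReal_eq hp0]
    simp only [enorm_gradient]
  set B := eLpNorm (gradient φ) P (volume.restrict Ω) with hBdef
  have hBtop : B ≠ ⊤ := (hφ.memLp_gradient P (volume.restrict Ω)).eLpNorm_lt_top.ne
  have hwm : AEStronglyMeasurable (𝒯.toFun w) (volume.restrict Ω) :=
    (𝒯.measurable_toFun w).aestronglyMeasurable
  have hφm : AEStronglyMeasurable φ (volume.restrict Ω) := hφ.1.continuous.aestronglyMeasurable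
  have herr : eLpNorm (φ - 𝒯.toFun w) P (volume.restrict Ω) ≤ κ * B := by
    rw [hP, eLpNorm_ofReal_eq hp0, hB]
    calc _ ≤ (κ ^ p * ∫⁻ x in Ω, ‖fderiv ℝ φ x‖ₑ ^ p) ^ (1 / p) :=
          ENNReal.rpow_le_rpow (𝒯.lintegral_sub_interpolate_rpow_le hd hΩ.measurableSet hp
            hφ.contDiff_one hφ.2.1 fun x hx => hφ.fderiv_eq_zero hx) (by positivity)
      _ = _ := by
          rw [ENNReal.mul_rpow_of_nonneg _ _ (by positivity), ← ENNReal.rpow_mul,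
            mul_one_div_cancel hp0.ne', ENNReal.rpow_one]
  have hwtop : eLpNorm (𝒯.toFun w) P (volume.restrict Ω) ≠ ⊤ := by
    have e : 𝒯.toFun w = φ - (φ - 𝒯.toFun w) := by abel
    rw [e]
    refine ((eLpNorm_sub_le hφm (hφm.sub hwm) hP1).trans_lt (ENNReal.add_lt_top.2 ⟨?_, ?_⟩)).ne
    · exact (hφ.memLp P (volume.restrict Ω)).eLpNorm_lt_top
    · exact herr.trans_lt (ENNReal.mul_lt_top ENNReal.ofReal_lt_top hBtop.lt_top)
  have hdisc : m * eLpNorm (𝒯.toFun w) P (volume.restrict Ω) ≤ B := by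
    rw [hP, eLpNorm_ofReal_eq hp0, hB, hm,
      ← ENNReal.ofReal_rpow_of_nonneg hμ (by positivity : 0 ≤ 1 / p),
      ← ENNReal.mul_rpow_of_nonneg _ _ (by positivity : 0 ≤ 1 / p)]
    refine ENNReal.rpow_le_rpow ?_ (by positivity)
    have hLtop : ∫⁻ x in Ω, ‖𝒯.toFun w x‖ₑ ^ p ≠ ⊤ := by
      intro htop
      rw [hP, eLpNorm_ofReal_eq hp0, htop, ENNReal.top_rpow_of_pos (by positivity)] at hwtop
      exact hwtop rfl
    have hint : ∫⁻ x in Ω, ‖𝒯.toFun w x‖ₑ ^ p =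
        ENNReal.ofReal (∫ x in Ω, |𝒯.toFun w x| ^ p) := by
      rw [integral_eq_lintegral_of_nonneg_ae (.of_forall fun x => by positivity)
        (((𝒯.measurable_toFun w).abs.pow_const p).aestronglyMeasurable)]
      have : ∀ x, ENNReal.ofReal (|𝒯.toFun w x| ^ p) = ‖𝒯.toFun w x‖ₑ ^ p := fun x => by
        rw [← ENNReal.ofReal_rpow_of_nonneg (abs_nonneg _) hp0.le, ← Real.norm_eq_abs, ofReal_norm]
      simp only [this]
      rw [ENNReal.ofReal_toReal hLtop]
    rw [hint, ← ENNReal.ofReal_mul hμ]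
    refine (ENNReal.ofReal_le_ofReal (h.mul_integral_le hp0
      (𝒯.interpolate_mem_crouzeixRaviart hd hΩ hφ.contDiff_one fun x hx => hφ.eq_zero hx))).trans ?_
    exact 𝒯.energy_interpolate_le hΩ.measurableSet hp hφ.contDiff_one
      fun x hx => hφ.fderiv_eq_zero hx
  calc m * eLpNorm φ P (volume.restrict Ω)
      = m * eLpNorm (𝒯.toFun w + (φ - 𝒯.toFun w)) P (volume.restrict Ω) := by
        rw [add_sub_cancel]
    _ ≤ m * (eLpNorm (𝒯.toFun w) P (volume.restrict Ω) + κ * B) := by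
        gcongr
        exact (eLpNorm_add_le hwm (hφm.sub hwm) hP1).trans (add_le_add le_rfl herr)
    _ = m * eLpNorm (𝒯.toFun w) P (volume.restrict Ω) + m * (κ * B) := mul_add _ _ _
    _ ≤ B + m * (κ * B) := by gcongr
    _ = _ := by
        have hh := 𝒯.maxDiam_nonneg
        rw [ENNReal.ofReal_add zero_le_one (by positivity), ENNReal.ofReal_one,
          ENNReal.ofReal_mul (by positivity)]
        ring

/-- The lower bound for `W₀^{1,p}(Ω)`, by density of the test functions. -/
theorem IsDiscreteSolution.eLpNorm_le_of_memW0 (h : 𝒯.IsDiscreteSolution p μ u) (hp : 1 < p)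
    (hd : d ≠ 0) (hΩ : IsOpen Ω) {v : EuclideanSpace ℝ (Fin d) → ℝ}
    {g : EuclideanSpace ℝ (Fin d) → EuclideanSpace ℝ (Fin d)} (hv : MemW0 p Ω v g) :
    ENNReal.ofReal (μ ^ (1 / p)) * eLpNorm v (ENNReal.ofReal p) (volume.restrict Ω) ≤
      ENNReal.ofReal (1 + (1 + d / 2) * 𝒯.maxDiam * μ ^ (1 / p)) *
        eLpNorm g (ENNReal.ofReal p) (volume.restrict Ω) := by
  obtain ⟨φ, hφ, hlim, hlimg⟩ := hv.approx
  set P := ENNReal.ofReal p with hP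
  have hP1 : 1 ≤ P := by rw [hP]; simpa using hp.le
  set m := ENNReal.ofReal (μ ^ (1 / p))
  set K := ENNReal.ofReal (1 + (1 + d / 2) * 𝒯.maxDiam * μ ^ (1 / p))
  have hmtop : m ≠ ⊤ := ENNReal.ofReal_ne_top
  have hKtop : K ≠ ⊤ := ENNReal.ofReal_ne_top
  have hle : ∀ n, m * eLpNorm v P (volume.restrict Ω) ≤
      K * (eLpNorm g P (volume.restrict Ω) +
        eLpNorm (fun x => gradient (φ n) x - g x) P (volume.restrict Ω)) +
      m * eLpNorm (fun x => φ n x - v x) P (volume.restrict Ω) := by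
    intro n
    have hφm : AEStronglyMeasurable (φ n) (volume.restrict Ω) :=
      (hφ n).1.continuous.aestronglyMeasurable
    have hgm : AEStronglyMeasurable (gradient (φ n)) (volume.restrict Ω) :=
      (hφ n).continuous_gradient.aestronglyMeasurable
    have h1 : eLpNorm v P (volume.restrict Ω) ≤ eLpNorm (φ n) P (volume.restrict Ω) +
        eLpNorm (fun x => φ n x - v x) P (volume.restrict Ω) := by
      have e : v = φ n - fun x => φ n x - v x := by ext x; simp
      nth_rw 1 [e]
      exact eLpNorm_sub_le hφm (hφm.sub hv.memLp.1) hP1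
    have h2 : eLpNorm (gradient (φ n)) P (volume.restrict Ω) ≤ eLpNorm g P (volume.restrict Ω) +
        eLpNorm (fun x => gradient (φ n) x - g x) P (volume.restrict Ω) := by
      have e : gradient (φ n) = g + fun x => gradient (φ n) x - g x := by ext x; simp
      nth_rw 1 [e]
      exact eLpNorm_add_le hv.memLp_grad.1 (hgm.sub hv.memLp_grad.1) hP1
    calc _ ≤ m * (eLpNorm (φ n) P (volume.restrict Ω) +
          eLpNorm (fun x => φ n x - v x) P (volume.restrict Ω)) := by gcongr
      _ = m * eLpNorm (φ n) P (volume.restrict Ω) +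
          m * eLpNorm (fun x => φ n x - v x) P (volume.restrict Ω) := mul_add _ _ _
      _ ≤ K * eLpNorm (gradient (φ n)) P (volume.restrict Ω) +
          m * eLpNorm (fun x => φ n x - v x) P (volume.restrict Ω) := by
          exact add_le_add (h.eLpNorm_le hp hd hΩ (hφ n)) le_rfl
      _ ≤ _ := by gcongr
  refine ge_of_tendsto' (x := atTop) ?_ hle
  have t1 := ENNReal.Tendsto.const_mul (a := K)
    (hlimg.const_add (eLpNorm g P (volume.restrict Ω))) (Or.inr hKtop)
  have t2 := ENNReal.Tendsto.const_mul (a := m) hlim (Or.inr hmtop)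
  simpa using t1.add t2

/-- The lower bound for one Rayleigh quotient. -/
theorem IsDiscreteSolution.div_le_rayleigh_rpow (h : 𝒯.IsDiscreteSolution p μ u) (hp : 1 < p)
    (hd : d ≠ 0) (hΩ : IsOpen Ω) {v : EuclideanSpace ℝ (Fin d) → ℝ}
    {g : EuclideanSpace ℝ (Fin d) → EuclideanSpace ℝ (Fin d)} (hv : MemW0 p Ω v g)
    (hv0 : ¬ (v =ᵐ[volume.restrict Ω] 0)) :
    μ ^ (1 / p) / (1 + (1 + (d : ℝ) / 2) * 𝒯.maxDiam * μ ^ (1 / p)) ≤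
      ((∫ x in Ω, ‖g x‖ ^ p) / ∫ x in Ω, |v x| ^ p) ^ (1 / p) := by
  have hp0 : 0 < p := by linarith
  have hμ := h.nonneg
  have hh := 𝒯.maxDiam_nonneg
  have hPr : (ENNReal.ofReal p).toReal = p := ENNReal.toReal_ofReal hp0.le
  have hP0 : ENNReal.ofReal p ≠ 0 := by simpa using hp0
  have key := h.eLpNorm_le_of_memW0 hp hd hΩ hv
  have hne : eLpNorm v (ENNReal.ofReal p) (volume.restrict Ω) ≠ 0 := fun h0 =>
    hv0 ((eLpNorm_eq_zero_iff hv.memLp.1 hP0).1 h0)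
  rw [hv.memLp.eLpNorm_eq_integral_rpow_norm hP0 ENNReal.ofReal_ne_top, hPr] at hne
  rw [hv.memLp.eLpNorm_eq_integral_rpow_norm hP0 ENNReal.ofReal_ne_top,
    hv.memLp_grad.eLpNorm_eq_integral_rpow_norm hP0 ENNReal.ofReal_ne_top, hPr,
    ← ENNReal.ofReal_mul (by positivity), ← ENNReal.ofReal_mul (by positivity),
    ENNReal.ofReal_le_ofReal_iff (mul_nonneg (by positivity)
      (Real.rpow_nonneg (integral_nonneg fun x => by positivity) _))] at key
  simp only [Real.norm_eq_abs, ne_eq, ENNReal.ofReal_eq_zero, not_le, ← one_div] at hne key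
  have hA : 0 ≤ ∫ x in Ω, ‖g x‖ ^ p := integral_nonneg fun x => by positivity
  have hD : 0 ≤ ∫ x in Ω, |v x| ^ p := integral_nonneg fun x => by positivity
  rw [Real.div_rpow hA hD, div_le_div_iff₀ (by positivity) hne, mul_comm (_ ^ (1 / p)) (1 + _)]
  exact key

end Triangulation

end Eigenvalue

end PLaplaceCR

end

theorem mainTheorem6 {d : ℕ} (hd : d = 2 ∨ d = 3) (p : ℝ) (hp : 1 < p)
    (Ω : Set (EuclideanSpace ℝ (Fin d))) (hΩ : IsOpen Ω) (hΩc : IsConnected Ω)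
    (𝒯 : ℕ → PLaplaceCR.Triangulation Ω) (μ : ℕ → ℝ) (u : ∀ k, (𝒯 k).PiecewiseAffine)
    (hu : ∀ k, (𝒯 k).IsDiscreteSolution p (μ k) (u k)) (k : ℕ)
    (hsmall : (1 + (d : ℝ) / 2) * (𝒯 k).maxDiam * PLaplaceCR.firstEigenvalue p Ω ^ (1 / p) < 1) :
    μ k ^ (1 / p) / (1 + (1 + (d : ℝ) / 2) * (𝒯 k).maxDiam * μ k ^ (1 / p)) ≤
      PLaplaceCR.firstEigenvalue p Ω ^ (1 / p) := by
  have hd0 : d ≠ 0 := by omega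
  have hp0 : 0 < p := by linarith
  have hμ := (hu k).nonneg
  have hh := (𝒯 k).maxDiam_nonneg
  set c := μ k ^ (1 / p) / (1 + (1 + (d : ℝ) / 2) * (𝒯 k).maxDiam * μ k ^ (1 / p)) with hc
  have hc0 : 0 ≤ c := by positivity
  obtain ⟨φ, hφ, hφ0⟩ := PLaplaceCR.exists_isTestFunction_ne_zero hΩ hΩc.nonempty
  have hle : c ^ p ≤ PLaplaceCR.firstEigenvalue p Ω := by
    refine le_csInf ⟨_, φ, gradient φ, hφ.memW0 p, hφ0, rfl⟩ ?_
    rintro r ⟨v, g, hv, hv0, rfl⟩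
    have hr : 0 ≤ (∫ x in Ω, ‖g x‖ ^ p) / ∫ x in Ω, |v x| ^ p :=
      div_nonneg (integral_nonneg fun x => by positivity) (integral_nonneg fun x => by positivity)
    have := Real.rpow_le_rpow hc0 ((hu k).div_le_rayleigh_rpow hp hd0 hΩ hv hv0) hp0.le
    rwa [← Real.rpow_mul hr, one_div_mul_cancel hp0.ne', Real.rpow_one] at this
  have := Real.rpow_le_rpow (by positivity) hle (by positivity : 0 ≤ 1 / p)
  rwa [← Real.rpow_mul hc0, mul_one_div_cancel hp0.ne', Real.rpow_one] at this
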